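/- Let $(\Omega,\mathcal F,\mathbb P)$ be an atomless probability space (equivalently, one carrying a random variable uniformly distributed on $[0,1]$), let $q\in[1,\infty)$, let $L^q$ be the normed space of random variables with finite $q$-th moment, and let $\mathcal M_{L^q}$ be the set of their distributions, written as distribution functions. Let $h:[0,1]\to\mathbb R$ be of bounded variation with $h(0)=0$, and let $$I_h(F)=\int_0^\infty h(1-F(x))\,\mathrm dx+\int_{-\infty}^0\bigl(h(1-F(x))-h(1)\bigr)\,\mathrm dx ,$$ with $I_h(X)=I_h(F)$ when $X$ has distribution $F$. Suppose that both integrals are finite for every $F\in\mathcal M_{L^q}$ and that $X\mapsto I_h(X)$ is continuous on $L^q$ with respect to the $L^q$-norm. Then the following are equivalent: (i) $h$ is convex on $[0,1]$; (ii) $I_h(F)\le I_h(G)$ for all $F,G\in\mathcal M_{L^q}$ such that $\int f\,\mathrm dF\le\int f\,\mathrm dG$ for all concave $f:\mathbb R\to\mathbb R$ (integrals with values in $[-\infty,\infty)$); (iii) $I_h(X+Y)\ge I_h(X)+I_h(Y)$ for all $X,Y\in L^q$; (iv) $X\mapsto I_h(X)$ is concave on $L^q$; (v) $X\mapsto I_h(X)$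 is quasi-concave on $L^q$; (vi) $I_h(\lambda F+(1-\lambda)G)\le\lambda I_h(F)+(1-\lambda)I_h(G)$ for all $F,G\in\mathcal M_{L^q}$ and $\lambda\in[0,1]$; (vii) $I_h(\lambda F+(1-\lambda)G)\le\max\{I_h(F),I_h(G)\}$ for all $F,G\in\mathcal M_{L^q}$ and $\lambda\in[0,1]$. Moreover, for all $\alpha\in(0,1)$ and $c\in[0,1]$, the mixed quantile $Q_\alpha^c=cQ_\alpha^++(1-c)Q_\alpha^-$, where $Q_\alpha^+(F)=\inf\{x:F(x)>\alpha\}$ and $Q_\alpha^-(F)=\inf\{x:F(x)\ge\alpha\}$, is not continuous on $L^q$ with respect to the $L^q$-norm (as the map sending $X$ to the value of $Q_\alpha^c$ at the distribution of $X$). -/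

import Mathlib

open MeasureTheory ProbabilityTheory Set
open scoped ENNReal

noncomputable section

namespace SignedChoquet

/-- A distortion function: `h : [0,1] → ℝ` of bounded variation with `h 0 = 0`.
Only the values of `h` on `[0,1]` are ever used. -/
structure IsDistortion (h : ℝ → ℝ) : Prop where
  boundedVariation : BoundedVariationOn h (Icc 0 1)
  map_zero : h 0 = 0

/-- The signed Choquet integral of a distribution `μ` with distribution function `F`:
`I_h(F) = ∫_0^∞ h(1 - F(x)) dx + ∫_{-∞}^0 (h(1 - F(x)) - h(1)) dx`. -/
def choquet (h : ℝ → ℝ) (μ : Measure ℝ) : ℝ :=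
  (∫ x in Ioi (0 : ℝ), h (1 - cdf μ x)) + ∫ x in Iio (0 : ℝ), (h (1 - cdf μ x) - h 1)

/-- Both integrals in the definition of `I_h(F)` are finite. -/
def HasFiniteChoquet (h : ℝ → ℝ) (μ : Measure ℝ) : Prop :=
  IntegrableOn (fun x => h (1 - cdf μ x)) (Ioi (0 : ℝ)) ∧
    IntegrableOn (fun x => h (1 - cdf μ x) - h 1) (Iio (0 : ℝ))

/-- The mixture `t F + (1 - t) G` of two distributions, for `t ∈ [0,1]`. -/
def mixture (t : ℝ) (μ ν : Measure ℝ) : Measure ℝ :=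
  ENNReal.ofReal t • μ + ENNReal.ofReal (1 - t) • ν

/-- `ρ` is convex in mixtures on the set `M` of distributions. -/
def MConvexOn (M : Set (Measure ℝ)) (ρ : Measure ℝ → ℝ) : Prop :=
  ∀ μ ∈ M, ∀ ν ∈ M, ∀ t ∈ Icc (0 : ℝ) 1, ρ (mixture t μ ν) ≤ t * ρ μ + (1 - t) * ρ ν

/-- `ρ` is quasi-convex in mixtures on the set `M` of distributions. -/
def MQuasiConvexOn (M : Set (Measure ℝ)) (ρ : Measure ℝ → ℝ) : Prop :=
  ∀ μ ∈ M, ∀ ν ∈ M, ∀ t ∈ Icc (0 : ℝ) 1, ρ (mixture t μ ν) ≤ max (ρ μ) (ρ ν)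

/-- Concave order: `∫ f dμ ≤ ∫ f dν` for all concave `f : ℝ → ℝ`.
For distributions with finite mean the integral of a concave function exists in `[-∞, ∞)`, and it
is `-∞` exactly when the function is not integrable; the clause below is the inequality between
these extended values. -/
def ConcaveOrderLE (μ ν : Measure ℝ) : Prop :=
  ∀ f : ℝ → ℝ, ConcaveOn ℝ univ f → Integrable f μ →
    Integrable f ν ∧ ∫ x, f x ∂μ ≤ ∫ x, f x ∂ν

/-- `ρ` is monotone for the concave order on the set `M` of distributions. -/
def ConcaveOrderMonotoneOn (M : Set (Measure ℝ)) (ρ : Measure ℝ → ℝ) : Prop :=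
  ∀ μ ∈ M, ∀ ν ∈ M, ConcaveOrderLE μ ν → ρ μ ≤ ρ ν

/-- The left quantile `inf {x | F(x) ≥ α}`, for `α ∈ (0,1)`. -/
def leftQuantile (α : ℝ) (μ : Measure ℝ) : ℝ := sInf {x | α ≤ cdf μ x}

/-- The right quantile `inf {x | F(x) > α}`, for `α ∈ (0,1)`. -/
def rightQuantile (α : ℝ) (μ : Measure ℝ) : ℝ := sInf {x | α < cdf μ x}

/-- The mixed quantile `c Q⁺_α + (1 - c) Q⁻_α`. -/
def mixedQuantile (c α : ℝ) (μ : Measure ℝ) : ℝ :=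
  c * rightQuantile α μ + (1 - c) * leftQuantile α μ

variable {Ω : Type*} [MeasurableSpace Ω]

/-- The probability space carries a random variable that is uniform on `[0,1]`
(for a probability space this is the same as being atomless). -/
def SupportsUniform (P : Measure Ω) : Prop :=
  ∃ U : Ω → ℝ, Measurable U ∧ P.map U = (volume : Measure ℝ).restrict (Icc 0 1)

/-- The distribution of an element of `L^q`. -/
def law {P : Measure Ω} {q : ℝ≥0∞} (X : Lp ℝ q P) : Measure ℝ := P.map X

/-- The set of the distributions of all random variables in `L^q`. -/
def lawsLp (P : Measure Ω) (q : ℝ≥0∞) : Set (Measure ℝ) :=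
  Set.range (fun X : Lp ℝ q P => law X)

end SignedChoquet

end

/-!
Let `h` be convex. Its piecewise linear interpolations lie between `h` and its chord, so their
Choquet integrals converge to that of `h` by dominated convergence, and they are nonnegative
combinations of hinges `s ↦ (s - k)⁺` up to a linear term, which contributes a multiple of the mean.
For a hinge, the Rockafellar–Uryasev formula `I_h(F) = max_y ((1 - k) y - ∫ (y - x)⁺ dF)` makes both
monotonicity in the concave order and superlinearity in the random variable evident. Convexity in
mixtures is the pointwise convexity of the integrand.

Conversely, `L^q`-continuity along the indicators of the events `{U ≤ s}`, with `U` uniform, makes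
`h` continuous, so that midpoint convexity is enough. From (ii)–(v) it follows by testing on two
events `M`, `N` of equal probability, since `1_M + 1_N = 1_{M ∪ N} + 1_{M ∩ N}`. For (vii), two-step
laws show that `(s₁, s₂) ↦ d₁ h(s₁) + d₂ h(s₂)` is midpoint quasi-convex for all nonnegative `d₁`,
`d₂`. If `h` is not convex, it fails midpoint convexity at some `p` on all small scales, and using
this strict gap in one coordinate forces `h` to be constant on either side of `p`, a contradiction.

Along the same indicators a mixed quantile jumps from `0` to `1` at `s = 1 - α`.
-/

namespace SignedChoquet

open Filter Topology

section ConvexityCriteria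

variable {f : ℝ → ℝ} {a b : ℝ}

lemma exists_leftmost_max {x y z : ℝ} (hf : ContinuousOn f (Icc x y)) (hz : z ∈ Icc x y)
    (hx : f x < f z) (hy : f y < f z) :
    ∃ p ∈ Ioo x y, (∀ w ∈ Icc x y, f w ≤ f p) ∧ ∀ w ∈ Ico x p, f w < f p := by
  obtain ⟨m, hm, hmax⟩ := isCompact_Icc.exists_isMaxOn ⟨z, hz⟩ hf
  have hcompact : IsCompact (Icc x y ∩ f ⁻¹' {f m}) :=
    isCompact_Icc.of_isClosed_subset (hf.preimage_isClosed_of_isClosed isClosed_Icc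
      isClosed_singleton) inter_subset_left
  obtain ⟨p, ⟨hp, hpm : f p = f m⟩, hleast⟩ := hcompact.exists_isLeast ⟨m, hm, rfl⟩
  have hmax' : ∀ w ∈ Icc x y, f w ≤ f p := fun w hw => hpm ▸ hmax hw
  have hxp : x ≠ p := by rintro rfl; exact (hmax' z hz).not_gt hx
  have hpy : p ≠ y := by rintro rfl; exact (hmax' z hz).not_gt hy
  refine ⟨p, ⟨hp.1.lt_of_ne hxp, hp.2.lt_of_ne hpy⟩, hmax', fun w hw => ?_⟩
  have hwI : w ∈ Icc x y := ⟨hw.1, hw.2.le.trans hp.2⟩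
  exact (hmax' w hwI).lt_of_ne fun h => hw.2.not_ge (hleast ⟨hwI, h.trans hpm⟩)

/- Subtracting a chord above which `f` rises somewhere makes the ends of the interval equal, so that
`p` can be taken to be the leftmost maximizer in between. -/
lemma exists_midpoint_lt_of_not_convexOn (hf : ContinuousOn f (Icc a b))
    (hn : ¬ ConvexOn ℝ (Icc a b) f) :
    ∃ p δ₀, 0 < δ₀ ∧ a ≤ p - δ₀ ∧ p + δ₀ ≤ b ∧
      ∀ δ ∈ Ioc 0 δ₀, f (p - δ) + f (p + δ) < 2 * f p := by
  obtain ⟨x, hx, y, hy, hxy, s, t, hs, ht, hst, hlt⟩ : ∃ x ∈ Icc a b, ∃ y ∈ Icc a b, x < y ∧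
      ∃ s t : ℝ, 0 < s ∧ 0 < t ∧ s + t = 1 ∧ s * f x + t * f y < f (s * x + t * y) := by
    by_contra! hcon
    exact hn (LinearOrder.convexOn_of_lt (convex_Icc a b) fun x hx y hy hxy s t hs ht hst =>
      hcon x hx y hy hxy s t hs ht hst)
  set k := (f y - f x) / (y - x)
  have hk : k * (y - x) = f y - f x := div_mul_cancel₀ _ (sub_pos.2 hxy).ne'
  set g : ℝ → ℝ := fun w => f w - k * (w - x) with hg
  have hgx : g x = f x := by simp [hg]
  have hgy : g y = f x := by simp [hg, hk]
  have hgz : f x < g (s * x + t * y) := by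
    obtain rfl : s = 1 - t := by linarith
    have : k * ((1 - t) * x + t * y - x) = t * (f y - f x) := by rw [← hk]; ring
    simp only [hg, this]
    linarith
  have hgc : ContinuousOn g (Icc x y) :=
    (hf.mono (Icc_subset_Icc hx.1 hy.2)).sub (by fun_prop)
  obtain ⟨p, hp, hmax, hleft⟩ := exists_leftmost_max hgc
    (convex_Icc x y (left_mem_Icc.2 hxy.le) (right_mem_Icc.2 hxy.le) hs.le ht.le hst)
    (hgx ▸ hgz) (hgy ▸ hgz)
  have hlx := min_le_left (p - x) (y - p)
  have hly := min_le_right (p - x) (y - p)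
  refine ⟨p, min (p - x) (y - p), lt_min (by linarith [hp.1]) (by linarith [hp.2]),
    by linarith [hx.1], by linarith [hy.2], fun δ hδ => ?_⟩
  have hlt := hleft (p - δ) ⟨by linarith [hδ.2], by linarith [hδ.1]⟩
  have hle := hmax (p + δ) ⟨by linarith [hδ.1, hp.1], by linarith [hδ.2]⟩
  simp only [hg] at hlt hle
  linarith

lemma convexOn_of_midpoint (hf : ContinuousOn f (Icc a b))
    (hm : ∀ x ∈ Icc a b, ∀ y ∈ Icc a b, x ≤ y → 2 * f ((x + y) / 2) ≤ f x + f y) :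
    ConvexOn ℝ (Icc a b) f := by
  by_contra hn
  obtain ⟨p, δ, hδ, ha, hb, hlt⟩ := exists_midpoint_lt_of_not_convexOn hf hn
  have hle := hm (p - δ) ⟨ha, by linarith⟩ (p + δ) ⟨by linarith, hb⟩ (by linarith)
  rw [show (p - δ + (p + δ)) / 2 = p by ring] at hle
  exact (hlt δ ⟨hδ, le_rfl⟩).not_ge hle

lemma grid_le_of_midpoint_defect {u κ D ε : ℝ} (hε : 0 ≤ ε) (N : ℕ)
    (H : ∀ y ∈ Icc u (u + (N + 1) * ε), ∀ z ∈ Icc u (u + (N + 1) * ε),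
      κ * (f y - f z) ≤ D * (f y + f z - 2 * f ((y + z) / 2))) :
    κ * (f u + f (u + ε)) + D * (f (u + ε) - f u)
      ≤ κ * (f (u + N * ε) + f (u + (N + 1) * ε)) + D * (f (u + (N + 1) * ε) - f (u + N * ε)) := by
  induction N with
  | zero => simp
  | succ N ih =>
    have hN : (0 : ℝ) ≤ N * ε := by positivity
    push_cast at H ⊢
    have hsub : Icc u (u + (N + 1) * ε) ⊆ Icc u (u + (N + 1 + 1) * ε) :=
      Icc_subset_Icc_right (by linarith)
    have hstep := H (u + N * ε) ⟨by linarith, by linarith⟩ (u + (N + 1 + 1) * ε)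
      ⟨by linarith, le_rfl⟩
    rw [show (u + N * ε + (u + (N + 1 + 1) * ε)) / 2 = u + (N + 1) * ε by ring] at hstep
    linarith [ih fun y hy z hz => H y (hsub hy) z (hsub hz)]

lemma tendsto_div_nat_add_one_nhdsGE {r : ℝ} (hr : 0 ≤ r) :
    Tendsto (fun N : ℕ => r / (N + 1)) atTop (𝓝[Icc 0 r] 0) := by
  refine tendsto_nhdsWithin_iff.2 ⟨?_, Eventually.of_forall fun N => ⟨by positivity, ?_⟩⟩
  · simpa [div_eq_mul_inv] using
      (tendsto_one_div_add_atTop_nhds_zero_nat (𝕜 := ℝ)).const_mul r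
  · exact div_le_self hr (by linarith [(N.cast_nonneg : (0 : ℝ) ≤ N)])

lemma mul_le_mul_of_midpoint_defect {u v κ D : ℝ} (huv : u ≤ v) (hf : ContinuousOn f (Icc u v))
    (H : ∀ y ∈ Icc u v, ∀ z ∈ Icc u v,
      κ * (f y - f z) ≤ D * (f y + f z - 2 * f ((y + z) / 2))) :
    κ * f u ≤ κ * f v := by
  have hmesh := tendsto_div_nat_add_one_nhdsGE (sub_nonneg.2 huv)
  have hgrid (N : ℕ) :
      κ * (f u + f (u + (v - u) / (N + 1))) + D * (f (u + (v - u) / (N + 1)) - f u)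
        ≤ κ * (f (v - (v - u) / (N + 1)) + f v) + D * (f v - f (v - (v - u) / (N + 1))) := by
    have hN : u + ((N : ℝ) + 1) * ((v - u) / (N + 1)) = v := by field_simp; ring
    have h := grid_le_of_midpoint_defect (u := u) (κ := κ) (D := D)
      (div_nonneg (sub_nonneg.2 huv) N.cast_add_one_pos.le) N (hN.symm ▸ H)
    rwa [hN, show u + (N : ℝ) * ((v - u) / (N + 1)) = v - (v - u) / (N + 1) by linarith] at h
  have hleft : Tendsto (fun N : ℕ => f (u + (v - u) / (N + 1))) atTop (𝓝 (f u)) := by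
    have hcont : ContinuousOn (fun ε => f (u + ε)) (Icc 0 (v - u)) :=
      hf.comp (by fun_prop) fun ε hε => ⟨by linarith [hε.1], by linarith [hε.2]⟩
    simpa [Function.comp_def] using
      (hcont 0 ⟨le_rfl, sub_nonneg.2 huv⟩).tendsto.comp hmesh
  have hright : Tendsto (fun N : ℕ => f (v - (v - u) / (N + 1))) atTop (𝓝 (f v)) := by
    have hcont : ContinuousOn (fun ε => f (v - ε)) (Icc 0 (v - u)) :=
      hf.comp (by fun_prop) fun ε hε => ⟨by linarith [hε.2], by linarith [hε.1]⟩
    simpa [Function.comp_def] using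
      (hcont 0 ⟨le_rfl, sub_nonneg.2 huv⟩).tendsto.comp hmesh
  have hlim := le_of_tendsto_of_tendsto'
    (((hleft.const_add (f u)).const_mul κ).add ((hleft.sub_const (f u)).const_mul D))
    (((hright.add_const (f v)).const_mul κ).add ((hright.const_sub (f v)).const_mul D)) hgrid
  simp only [sub_self, mul_zero, add_zero] at hlim
  linarith

/- The weights `d₁ = |y₀ - y₁|` and `d₂ = |c₁ - c₀|` make the two entries of one of the two maxima
equal. -/
lemma mul_abs_le_of_weighted_le_max {c₀ c₁ c y₀ y₁ y : ℝ}
    (H : ∀ d₁ d₂ : ℝ, 0 ≤ d₁ → 0 ≤ d₂ →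
      d₁ * c + d₂ * y ≤ max (d₁ * c₀ + d₂ * y₀) (d₁ * c₁ + d₂ * y₁) ∧
      d₁ * c + d₂ * y ≤ max (d₁ * c₀ + d₂ * y₁) (d₁ * c₁ + d₂ * y₀)) :
    (2 * c - c₀ - c₁) * |y₀ - y₁| ≤ |c₁ - c₀| * (y₀ + y₁ - 2 * y) := by
  obtain ⟨h1, h2⟩ := H |y₀ - y₁| |c₁ - c₀| (abs_nonneg _) (abs_nonneg _)
  rw [le_max_iff] at h1 h2
  rcases abs_cases (y₀ - y₁) with ⟨ey, _⟩ | ⟨ey, _⟩ <;>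
  rcases abs_cases (c₁ - c₀) with ⟨ec, _⟩ | ⟨ec, _⟩ <;>
  rw [ey, ec] at h1 h2 ⊢ <;>
  rcases h1 with h1 | h1 <;> rcases h2 with h2 | h2 <;>
  linarith

/- The gap `2c - c₀ - c₁` turns increments of `f` into second differences, and these telescope. -/
lemma eq_of_weighted_quasiconvex {u v c₀ c₁ c : ℝ} (huv : u ≤ v) (hf : ContinuousOn f (Icc u v))
    (hc : c₀ + c₁ < 2 * c)
    (H : ∀ y ∈ Icc u v, ∀ z ∈ Icc u v, ∀ d₁ d₂ : ℝ, 0 ≤ d₁ → 0 ≤ d₂ →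
      d₁ * c + d₂ * f ((y + z) / 2) ≤ max (d₁ * c₀ + d₂ * f y) (d₁ * c₁ + d₂ * f z)) :
    f u = f v := by
  set κ := 2 * c - c₀ - c₁
  have hκ : 0 < κ := by linarith
  have hincr (y) (hy : y ∈ Icc u v) (z) (hz : z ∈ Icc u v) :
      κ * |f y - f z| ≤ |c₁ - c₀| * (f y + f z - 2 * f ((y + z) / 2)) := by
    refine mul_abs_le_of_weighted_le_max fun d₁ d₂ h1 h2 => ⟨H y hy z hz d₁ d₂ h1 h2, ?_⟩
    rw [add_comm y z]
    exact H z hz y hy d₁ d₂ h1 h2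
  have hle : κ * f u ≤ κ * f v := mul_le_mul_of_midpoint_defect huv hf fun y hy z hz =>
    (mul_le_mul_of_nonneg_left (le_abs_self _) hκ.le).trans (hincr y hy z hz)
  have hge : -κ * f u ≤ -κ * f v := mul_le_mul_of_midpoint_defect huv hf fun y hy z hz => by
    refine le_trans ?_ (hincr y hy z hz)
    nlinarith [neg_abs_le (f y - f z)]
  nlinarith

theorem convexOn_of_weighted_quasiconvex (hf : ContinuousOn f (Icc a b))
    (H : ∀ s₁ ∈ Icc a b, ∀ s₂ ∈ Icc a b, ∀ t₁ ∈ Icc a b, ∀ t₂ ∈ Icc a b, s₂ ≤ s₁ → t₂ ≤ t₁ →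
      ∀ d₁ d₂ : ℝ, 0 ≤ d₁ → 0 ≤ d₂ →
        d₁ * f ((s₁ + t₁) / 2) + d₂ * f ((s₂ + t₂) / 2)
          ≤ max (d₁ * f s₁ + d₂ * f s₂) (d₁ * f t₁ + d₂ * f t₂)) :
    ConvexOn ℝ (Icc a b) f := by
  by_contra hn
  obtain ⟨p, δ₀, hδ₀, ha, hb, hlt⟩ := exists_midpoint_lt_of_not_convexOn hf hn
  have hmid (δ : ℝ) : (p - δ + (p + δ)) / 2 = p := by ring
  have hleft (δ) (hδ : δ ∈ Ioc 0 δ₀) : f a = f (p - δ) := by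
    obtain ⟨h0, h1⟩ := hδ
    refine eq_of_weighted_quasiconvex (by linarith)
      (hf.mono (Icc_subset_Icc_right (by linarith))) (hlt δ ⟨h0, h1⟩)
      fun y hy z hz d₁ d₂ hd₁ hd₂ => ?_
    have hH := H (p - δ) ⟨by linarith, by linarith⟩ y ⟨hy.1, by linarith [hy.2]⟩ (p + δ)
      ⟨by linarith, by linarith⟩ z ⟨hz.1, by linarith [hz.2]⟩ hy.2 (by linarith [hz.2])
      d₁ d₂ hd₁ hd₂
    rwa [hmid] at hH
  have hright (δ) (hδ : δ ∈ Ioc 0 δ₀) : f (p + δ) = f b := by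
    obtain ⟨h0, h1⟩ := hδ
    refine eq_of_weighted_quasiconvex (by linarith)
      (hf.mono (Icc_subset_Icc_left (by linarith))) (hlt δ ⟨h0, h1⟩)
      fun y hy z hz d₁ d₂ hd₁ hd₂ => ?_
    have hH := H y ⟨by linarith [hy.1], hy.2⟩ (p - δ) ⟨by linarith, by linarith⟩ z
      ⟨by linarith [hz.1], hz.2⟩ (p + δ) ⟨by linarith, by linarith⟩ (by linarith [hy.1]) hz.1
      d₂ d₁ hd₂ hd₁
    rwa [hmid, add_comm (d₂ * _), add_comm (d₂ * _), add_comm (d₂ * _)] at hH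
  have hpa : f p = f a := by
    refine (show EqOn f (fun _ => f a) (Ico (p - δ₀) p) from fun w hw => ?_).of_subset_closure
      (hf.mono (Icc_subset_Icc ha (by linarith))) continuousOn_const Ico_subset_Icc_self
      (closure_Ico (by linarith)).ge (right_mem_Icc.2 (by linarith))
    simpa using (hleft (p - w) ⟨by linarith [hw.2], by linarith [hw.1]⟩).symm
  have hpb : f p = f b := by
    refine (show EqOn f (fun _ => f b) (Ioc p (p + δ₀)) from fun w hw => ?_).of_subset_closure
      (hf.mono (Icc_subset_Icc (by linarith) hb)) continuousOn_const Ioc_subset_Icc_self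
      (closure_Ioc (by linarith)).ge (left_mem_Icc.2 (by linarith))
    simpa using hright (w - p) ⟨by linarith [hw.1], by linarith [hw.2]⟩
  linarith [hlt δ₀ ⟨hδ₀, le_rfl⟩, hleft δ₀ ⟨hδ₀, le_rfl⟩, hright δ₀ ⟨hδ₀, le_rfl⟩]

end ConvexityCriteria

section ChoquetIntegral

variable {g h l u : ℝ → ℝ} {μ ν : Measure ℝ}

lemma one_sub_cdf_mem_Icc (μ : Measure ℝ) (x : ℝ) : 1 - cdf μ x ∈ Icc (0 : ℝ) 1 :=
  ⟨sub_nonneg.2 (cdf_le_one μ x), sub_le_self 1 (cdf_nonneg μ x)⟩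

/-- The integrand that combines the two integrals of `choquet h μ` into one over the whole line. -/
noncomputable def choquetIntegrand (h : ℝ → ℝ) (μ : Measure ℝ) (x : ℝ) : ℝ :=
  h (1 - cdf μ x) - (Iio 0).indicator (fun _ => h 1) x

lemma choquetIntegrand_of_neg {x : ℝ} (hx : x < 0) :
    choquetIntegrand h μ x = h (1 - cdf μ x) - h 1 := by
  rw [choquetIntegrand, indicator_of_mem (mem_Iio.2 hx)]

lemma choquetIntegrand_of_nonneg {x : ℝ} (hx : 0 ≤ x) :
    choquetIntegrand h μ x = h (1 - cdf μ x) := by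
  rw [choquetIntegrand, indicator_of_notMem (notMem_Iio.2 hx), sub_zero]

lemma hasFiniteChoquet_iff_integrable :
    HasFiniteChoquet h μ ↔ Integrable (choquetIntegrand h μ) := by
  rw [← integrableOn_univ, ← Iio_union_Ici (a := (0 : ℝ)), integrableOn_union,
    integrableOn_Ici_iff_integrableOn_Ioi, HasFiniteChoquet, and_comm]
  exact and_congr
    (integrableOn_congr_fun (fun x hx => (choquetIntegrand_of_neg hx).symm) measurableSet_Iio)
    (integrableOn_congr_fun (fun x hx => (choquetIntegrand_of_nonneg (le_of_lt hx)).symm)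
      measurableSet_Ioi)

lemma choquet_eq_integral (hh : HasFiniteChoquet h μ) :
    choquet h μ = ∫ x, choquetIntegrand h μ x := by
  rw [← integral_add_compl measurableSet_Ioi (hasFiniteChoquet_iff_integrable.1 hh), compl_Ioi,
    integral_Iic_eq_integral_Iio, choquet]
  exact congrArg₂ (· + ·)
    (setIntegral_congr_fun measurableSet_Ioi fun x hx =>
      (choquetIntegrand_of_nonneg (le_of_lt hx)).symm)
    (setIntegral_congr_fun measurableSet_Iio fun x hx => (choquetIntegrand_of_neg hx).symm)

lemma HasFiniteChoquet.add (hg : HasFiniteChoquet g μ) (hh : HasFiniteChoquet h μ) :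
    HasFiniteChoquet (fun s => g s + h s) μ :=
  ⟨hg.1.add hh.1, (hg.2.add hh.2).congr (ae_of_all _ fun _ => (add_sub_add_comm _ _ _ _).symm)⟩

lemma HasFiniteChoquet.const_mul (hh : HasFiniteChoquet h μ) (c : ℝ) :
    HasFiniteChoquet (fun s => c * h s) μ :=
  ⟨hh.1.const_mul c, (hh.2.const_mul c).congr (ae_of_all _ fun _ => mul_sub _ _ _)⟩

lemma HasFiniteChoquet.sum {ι : Type*} {s : Finset ι} {f : ι → ℝ → ℝ}
    (hf : ∀ i ∈ s, HasFiniteChoquet (f i) μ) : HasFiniteChoquet (fun t => ∑ i ∈ s, f i t) μ := by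
  refine ⟨integrable_finsetSum s fun i hi => (hf i hi).1, ?_⟩
  simp only [← Finset.sum_sub_distrib]
  exact integrable_finsetSum s fun i hi => (hf i hi).2

lemma choquet_add (hg : HasFiniteChoquet g μ) (hh : HasFiniteChoquet h μ) :
    choquet (fun s => g s + h s) μ = choquet g μ + choquet h μ := by
  simp only [choquet, add_sub_add_comm]
  rw [integral_add hg.1 hh.1, integral_add hg.2 hh.2, add_add_add_comm]

lemma choquet_const_mul (c : ℝ) : choquet (fun s => c * h s) μ = c * choquet h μ := by
  simp only [choquet, ← mul_sub, integral_const_mul, ← mul_add]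

lemma choquet_sum {ι : Type*} {s : Finset ι} {f : ι → ℝ → ℝ}
    (hf : ∀ i ∈ s, HasFiniteChoquet (f i) μ) :
    choquet (fun t => ∑ i ∈ s, f i t) μ = ∑ i ∈ s, choquet (f i) μ := by
  simp only [choquet, ← Finset.sum_sub_distrib, Finset.sum_add_distrib]
  rw [integral_finsetSum s fun i hi => (hf i hi).1, integral_finsetSum s fun i hi => (hf i hi).2]

lemma tendsto_choquet {f : ℕ → ℝ → ℝ} (hl : HasFiniteChoquet l μ) (hu : HasFiniteChoquet u μ)
    (hf : ∀ n, HasFiniteChoquet (f n) μ) (hh : HasFiniteChoquet h μ)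
    (hlf : ∀ n, ∀ s ∈ Icc (0 : ℝ) 1, l s ≤ f n s) (hfu : ∀ n, ∀ s ∈ Icc (0 : ℝ) 1, f n s ≤ u s)
    (hlu : l 1 = u 1) (hlim : ∀ s ∈ Icc (0 : ℝ) 1, Tendsto (fun n => f n s) atTop (𝓝 (h s))) :
    Tendsto (fun n => choquet (f n) μ) atTop (𝓝 (choquet h μ)) := by
  have h1 : (1 : ℝ) ∈ Icc (0 : ℝ) 1 := right_mem_Icc.2 zero_le_one
  have hS := one_sub_cdf_mem_Icc μ
  have hf1 (n : ℕ) : f n 1 = l 1 := le_antisymm (hlu ▸ hfu n 1 h1) (hlf n 1 h1)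
  have hbound (n : ℕ) (x : ℝ) : choquetIntegrand l μ x ≤ choquetIntegrand (f n) μ x ∧
      choquetIntegrand (f n) μ x ≤ choquetIntegrand u μ x := by
    simp only [choquetIntegrand, hf1, ← hlu, sub_le_sub_iff_right]
    exact ⟨hlf n _ (hS x), hfu n _ (hS x)⟩
  rw [choquet_eq_integral hh]
  simp only [fun n => choquet_eq_integral (hf n)]
  refine tendsto_integral_of_dominated_convergence
    (fun x => max |choquetIntegrand l μ x| |choquetIntegrand u μ x|)
    (fun n => (hasFiniteChoquet_iff_integrable.1 (hf n)).aestronglyMeasurable)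
    ((hasFiniteChoquet_iff_integrable.1 hl).abs.sup (hasFiniteChoquet_iff_integrable.1 hu).abs)
    (fun n => ae_of_all _ fun x => abs_le_max_abs_abs (hbound n x).1 (hbound n x).2)
    (ae_of_all _ fun x => ?_)
  by_cases hx : x < 0
  · simp only [choquetIntegrand_of_neg hx]
    exact (hlim _ (hS x)).sub (hlim 1 h1)
  · simp only [choquetIntegrand_of_nonneg (not_lt.1 hx)]
    exact hlim _ (hS x)

lemma HasFiniteChoquet.map_zero (hh : HasFiniteChoquet h μ) {b : ℝ}
    (hb : ∀ x, b < x → cdf μ x = 1) : h 0 = 0 := by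
  have hconst : IntegrableOn (fun _ => h 0) (Ioi (max b 0)) :=
    (hh.1.mono_set (Ioi_subset_Ioi (le_max_right b 0))).congr_fun (fun x hx => by
      simp only [hb x ((le_max_left b 0).trans_lt hx), sub_self]) measurableSet_Ioi
  simpa [integrableOn_const_iff] using hconst

lemma isProbabilityMeasure_mixture [IsProbabilityMeasure μ] [IsProbabilityMeasure ν] {t : ℝ}
    (ht : t ∈ Icc (0 : ℝ) 1) : IsProbabilityMeasure (mixture t μ ν) := by
  refine ⟨?_⟩
  rw [mixture, Measure.add_apply, Measure.smul_apply, Measure.smul_apply, measure_univ,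
    measure_univ, smul_eq_mul, smul_eq_mul, mul_one, mul_one,
    ← ENNReal.ofReal_add ht.1 (sub_nonneg.2 ht.2), add_sub_cancel, ENNReal.ofReal_one]

lemma cdf_mixture [IsProbabilityMeasure μ] [IsProbabilityMeasure ν] {t : ℝ}
    (ht : t ∈ Icc (0 : ℝ) 1) (x : ℝ) :
    cdf (mixture t μ ν) x = t * cdf μ x + (1 - t) * cdf ν x := by
  have := isProbabilityMeasure_mixture (μ := μ) (ν := ν) ht
  have := μ.smul_finite (ENNReal.ofReal_ne_top (r := t))
  have := ν.smul_finite (ENNReal.ofReal_ne_top (r := 1 - t))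
  rw [cdf_eq_real, cdf_eq_real, cdf_eq_real, mixture, measureReal_add_apply,
    measureReal_ennreal_smul_apply, measureReal_ennreal_smul_apply,
    ENNReal.toReal_ofReal ht.1, ENNReal.toReal_ofReal (sub_nonneg.2 ht.2)]

lemma choquet_mixture_le [IsProbabilityMeasure μ] [IsProbabilityMeasure ν]
    (hconv : ConvexOn ℝ (Icc (0 : ℝ) 1) h) {t : ℝ} (ht : t ∈ Icc (0 : ℝ) 1)
    (hμ : HasFiniteChoquet h μ) (hν : HasFiniteChoquet h ν)
    (hm : HasFiniteChoquet h (mixture t μ ν)) :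
    choquet h (mixture t μ ν) ≤ t * choquet h μ + (1 - t) * choquet h ν := by
  have hpt (x : ℝ) : choquetIntegrand h (mixture t μ ν) x
      ≤ t * choquetIntegrand h μ x + (1 - t) * choquetIntegrand h ν x := by
    have hx := hconv.2 (one_sub_cdf_mem_Icc μ x) (one_sub_cdf_mem_Icc ν x) ht.1
      (sub_nonneg.2 ht.2) (add_sub_cancel t 1)
    simp only [smul_eq_mul] at hx
    rw [show t * (1 - cdf μ x) + (1 - t) * (1 - cdf ν x) = 1 - cdf (mixture t μ ν) x by
      rw [cdf_mixture ht]; ring] at hx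
    simp only [choquetIntegrand]
    linarith
  rw [hasFiniteChoquet_iff_integrable] at hμ hν hm
  rw [choquet_eq_integral (hasFiniteChoquet_iff_integrable.2 hm),
    choquet_eq_integral (hasFiniteChoquet_iff_integrable.2 hμ),
    choquet_eq_integral (hasFiniteChoquet_iff_integrable.2 hν), ← integral_const_mul,
    ← integral_const_mul, ← integral_add (hμ.const_mul t) (hν.const_mul (1 - t))]
  exact integral_mono hm ((hμ.const_mul t).add (hν.const_mul (1 - t))) hpt

end ChoquetIntegral

section TailIntegrals

variable {μ : Measure ℝ} [IsProbabilityMeasure μ]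

lemma integrableOn_measureReal_le {α : Type*} [MeasurableSpace α] {ν : Measure α}
    [IsFiniteMeasure ν] {f : α → ℝ} (hf : Integrable f ν) (hf0 : 0 ≤ f) :
    IntegrableOn (fun t => ν.real {a | t ≤ f a}) (Ioi 0) := by
  have hanti : Antitone fun t => ν.real {a | t ≤ f a} := fun s t hst =>
    measureReal_mono fun a ha => hst.trans ha
  refine ⟨hanti.measurable.aestronglyMeasurable, ?_⟩
  rw [hasFiniteIntegral_iff_ofReal (ae_of_all _ fun t => measureReal_nonneg)]
  simp only [measureReal_def, ENNReal.ofReal_toReal (measure_ne_top ν _)]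
  rw [← lintegral_eq_lintegral_meas_le ν (ae_of_all _ hf0) hf.aemeasurable]
  exact hf.lintegral_lt_top

lemma integrable_posPart_sub (hμ : Integrable (fun x => x) μ) (y : ℝ) :
    Integrable (fun x => max (y - x) 0) μ :=
  ((integrable_const y).sub hμ).sup (integrable_const 0)

lemma measureReal_le_posPart_sub {t : ℝ} (ht : 0 < t) (y : ℝ) :
    μ.real {x | t ≤ max (y - x) 0} = cdf μ (y - t) := by
  rw [cdf_eq_real]
  congr 1
  ext x
  simp only [mem_ofPred_eq, le_max_iff, ht.not_ge, or_false, mem_Iic, le_sub_comm]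

lemma integrableOn_cdf (hμ : Integrable (fun x => x) μ) (y : ℝ) : IntegrableOn (cdf μ) (Iio y) := by
  rw [← (Measure.measurePreserving_sub_left volume y).integrableOn_comp_preimage
    (MeasurableEquiv.subLeft y).measurableEmbedding, preimage_const_sub_Iio, sub_self]
  exact (integrableOn_measureReal_le (integrable_posPart_sub hμ y)
    fun _ => le_max_right _ _).congr_fun (fun t ht => measureReal_le_posPart_sub ht y)
    measurableSet_Ioi

lemma setIntegral_cdf (hμ : Integrable (fun x => x) μ) (y : ℝ) :
    ∫ x in Iio y, cdf μ x = ∫ x, max (y - x) 0 ∂μ := by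
  rw [(integrable_posPart_sub hμ y).integral_eq_integral_meas_le
      (ae_of_all _ fun _ => le_max_right _ _),
    setIntegral_congr_fun measurableSet_Ioi fun t ht => measureReal_le_posPart_sub ht y,
    ← (Measure.measurePreserving_sub_left volume y).setIntegral_preimage_emb
      (MeasurableEquiv.subLeft y).measurableEmbedding, preimage_const_sub_Iio, sub_self]

lemma measureReal_lt_posPart {t : ℝ} (ht : 0 < t) : μ.real {x | t < max x 0} = 1 - cdf μ t := by
  rw [cdf_eq_real, ← probReal_compl_eq_one_sub measurableSet_Iic]
  congr 1
  ext x
  simp [ht.not_gt]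

lemma integrableOn_one_sub_cdf (hμ : Integrable (fun x => x) μ) :
    IntegrableOn (fun x => 1 - cdf μ x) (Ioi 0) := by
  refine (integrableOn_measureReal_le (hμ.sup (integrable_const 0))
    fun _ => le_max_right _ _).congr_fun_ae ?_
  filter_upwards [meas_le_ae_eq_meas_lt μ (volume.restrict (Ioi 0)) fun x => max x 0,
    ae_restrict_mem measurableSet_Ioi] with t hle ht
  rw [← measureReal_lt_posPart ht]
  exact congrArg ENNReal.toReal hle

lemma setIntegral_one_sub_cdf (hμ : Integrable (fun x => x) μ) :
    ∫ x in Ioi 0, (1 - cdf μ x) = ∫ x, max x 0 ∂μ := by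
  have hpos : Integrable (fun x => max x 0) μ := hμ.sup (integrable_const 0)
  rw [hpos.integral_eq_integral_meas_lt (ae_of_all _ fun _ => le_max_right _ _),
    setIntegral_congr_fun measurableSet_Ioi fun t ht => measureReal_lt_posPart ht]

lemma hasFiniteChoquet_of_lipschitzWith (hμ : Integrable (fun x => x) μ) {h : ℝ → ℝ} {K : NNReal}
    (hh : LipschitzWith K h) (h0 : h 0 = 0) : HasFiniteChoquet h μ := by
  constructor
  · exact memLp_one_iff_integrable.1
      (hh.comp_memLp h0 (memLp_one_iff_integrable.2 (integrableOn_one_sub_cdf hμ)))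
  · have hshift : LipschitzWith K fun s => h (1 - s) - h 1 := by
      refine LipschitzWith.of_dist_le_mul fun s t => ?_
      simpa only [dist_sub_right, dist_sub_left] using hh.dist_le_mul (1 - s) (1 - t)
    exact memLp_one_iff_integrable.1
      (hshift.comp_memLp (by simp) (memLp_one_iff_integrable.2 (integrableOn_cdf hμ 0)))

lemma hasFiniteChoquet_id (hμ : Integrable (fun x => x) μ) : HasFiniteChoquet (fun s => s) μ :=
  hasFiniteChoquet_of_lipschitzWith hμ LipschitzWith.id rfl

lemma choquet_id (hμ : Integrable (fun x => x) μ) : choquet (fun s => s) μ = ∫ x, x ∂μ := by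
  have hpos : Integrable (fun x => max x 0) μ := hμ.sup (integrable_const 0)
  simp only [choquet, sub_sub_cancel_left, integral_neg, ← sub_eq_add_neg]
  rw [setIntegral_one_sub_cdf hμ, setIntegral_cdf hμ,
    ← integral_sub hpos (integrable_posPart_sub hμ 0)]
  refine integral_congr_ae (ae_of_all _ fun x => ?_)
  simpa only [zero_sub, max_comm] using max_zero_sub_max_neg_zero_eq_self x

end TailIntegrals

section Hinge

variable {μ : Measure ℝ} {k : ℝ}

/-- The convex distortion function `s ↦ (s - k)⁺`; convex piecewise linear distortion functions are
nonnegative combinations of these, up to a linear term. -/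
noncomputable def hinge (k s : ℝ) : ℝ := max (s - k) 0

lemma hinge_of_le {s : ℝ} (hs : k ≤ s) : hinge k s = s - k := max_eq_left (sub_nonneg.2 hs)

lemma hinge_of_ge {s : ℝ} (hs : s ≤ k) : hinge k s = 0 := max_eq_right (sub_nonpos.2 hs)

lemma lipschitzWith_hinge (k : ℝ) : LipschitzWith 1 (hinge k) :=
  (LipschitzWith.of_dist_le_mul fun s t => by simp).max_const 0

/-- The integrand over the real line of the Rockafellar–Uryasev objective
`(1 - k) y - ∫ (y - x)⁺ dμ(x)`, whose maximum over `y` is `I_h(μ)` for the hinge `h` at `k`. -/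
noncomputable def rockafellarIntegrand (k y : ℝ) (μ : Measure ℝ) (x : ℝ) : ℝ :=
  (Iio y).indicator (fun x => 1 - cdf μ x - k) x - (Iio (0 : ℝ)).indicator (fun _ => 1 - k) x

lemma choquetIntegrand_hinge (hk : k ≤ 1) (x : ℝ) :
    choquetIntegrand (hinge k) μ x =
      hinge k (1 - cdf μ x) - (Iio (0 : ℝ)).indicator (fun _ => 1 - k) x := by
  simp only [choquetIntegrand, hinge_of_le hk]

lemma rockafellarIntegrand_le_choquetIntegrand_hinge (hk : k ≤ 1) (y x : ℝ) :
    rockafellarIntegrand k y μ x ≤ choquetIntegrand (hinge k) μ x := by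
  rw [choquetIntegrand_hinge hk]
  exact sub_le_sub_right
    (indicator_le' (fun _ _ => le_max_left _ _) (fun _ _ => le_max_right _ _) x) _

lemma one_sub_cdf_dirac (y x : ℝ) :
    1 - cdf (Measure.dirac y) x = (Iio y).indicator (fun _ => 1) x := by
  rw [cdf_eq_real, ← probReal_compl_eq_one_sub measurableSet_Iic, compl_Iic,
    measureReal_def, Measure.dirac_apply' y measurableSet_Ioi]
  by_cases hx : x < y <;> simp [hx]

lemma rockafellarIntegrand_eq (k y : ℝ) : rockafellarIntegrand k y μ = fun x =>
    (1 - k) * choquetIntegrand (fun s => s) (Measure.dirac y) x - (Iio y).indicator (cdf μ) x := by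
  funext x
  rw [rockafellarIntegrand, choquetIntegrand, one_sub_cdf_dirac]
  by_cases hy : x < y <;> by_cases h0 : x < 0 <;> simp [hy, h0]
  ring

lemma cdf_le_of_lt_leftQuantile {p x : ℝ} (hp : 0 < p) (hx : x < leftQuantile p μ) :
    cdf μ x ≤ p := by
  have hbdd : BddBelow {x | p ≤ cdf μ x} := by
    obtain ⟨b, hb⟩ := ((tendsto_cdf_atBot μ).eventually (eventually_lt_nhds hp)).exists
    exact ⟨b, fun x hx => not_lt.1 fun hlt => (hx.trans (monotone_cdf μ hlt.le)).not_gt hb⟩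
  exact (not_le.1 fun h : p ≤ cdf μ x => notMem_of_lt_csInf hx hbdd h).le

lemma le_cdf_of_leftQuantile_lt {p x : ℝ} (hp : p < 1) (hx : leftQuantile p μ < x) :
    p ≤ cdf μ x := by
  have hne : {x | p ≤ cdf μ x}.Nonempty :=
    ((tendsto_cdf_atTop μ).eventually (eventually_ge_nhds hp)).exists
  obtain ⟨z, hz, hzx⟩ := exists_lt_of_csInf_lt hne hx
  exact le_trans hz (monotone_cdf μ hzx.le)

variable [IsProbabilityMeasure μ]

lemma integrable_rockafellarIntegrand (hμ : Integrable (fun x => x) μ) (k y : ℝ) :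
    Integrable (rockafellarIntegrand k y μ) := by
  rw [rockafellarIntegrand_eq]
  exact ((hasFiniteChoquet_iff_integrable.1 (hasFiniteChoquet_id (integrable_dirac
    (by simp)))).const_mul (1 - k)).sub ((integrableOn_cdf hμ y).integrable_indicator
      measurableSet_Iio)

lemma integral_rockafellarIntegrand (hμ : Integrable (fun x => x) μ) (k y : ℝ) :
    ∫ x, rockafellarIntegrand k y μ x = (1 - k) * y - ∫ x, max (y - x) 0 ∂μ := by
  have hdirac : Integrable (fun x : ℝ => x) (Measure.dirac y) := integrable_dirac (by simp)
  have hfin := hasFiniteChoquet_id hdirac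
  have hid : ∫ x, choquetIntegrand (fun s => s) (Measure.dirac y) x = y := by
    rw [← choquet_eq_integral hfin, choquet_id hdirac, integral_dirac]
  simp only [rockafellarIntegrand_eq]
  rw [integral_sub ((hasFiniteChoquet_iff_integrable.1 hfin).const_mul (1 - k))
    ((integrableOn_cdf hμ y).integrable_indicator measurableSet_Iio), integral_const_mul, hid,
    integral_indicator measurableSet_Iio, setIntegral_cdf hμ]

theorem isGreatest_choquet_hinge (hμ : Integrable (fun x => x) μ) (hk : k ∈ Ioo (0 : ℝ) 1) :
    IsGreatest (range fun y => (1 - k) * y - ∫ x, max (y - x) 0 ∂μ) (choquet (hinge k) μ) := by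
  have hfin := hasFiniteChoquet_of_lipschitzWith hμ (lipschitzWith_hinge k) (hinge_of_ge hk.1.le)
  rw [choquet_eq_integral hfin]
  simp only [← integral_rockafellarIntegrand hμ]
  constructor
  · refine ⟨leftQuantile (1 - k) μ, integral_congr_ae ?_⟩
    filter_upwards [Measure.ae_ne volume (leftQuantile (1 - k) μ)] with x hx
    rw [rockafellarIntegrand, choquetIntegrand_hinge hk.2.le]
    rcases hx.lt_or_gt with hlt | hgt
    · rw [indicator_of_mem (mem_Iio.2 hlt), hinge_of_le]
      linarith [cdf_le_of_lt_leftQuantile (sub_pos.2 hk.2) hlt]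
    · rw [indicator_of_notMem (notMem_Iio.2 hgt.le), hinge_of_ge]
      linarith [le_cdf_of_leftQuantile_lt (sub_lt_self 1 hk.1) hgt]
  · rintro _ ⟨y, rfl⟩
    exact integral_mono (integrable_rockafellarIntegrand hμ k y)
      (hasFiniteChoquet_iff_integrable.1 hfin)
      (rockafellarIntegrand_le_choquetIntegrand_hinge hk.2.le y)

end Hinge

section Interpolation

/-- The `j`-th of the nodes `0, 1 / (n + 1), …, 1` that divide `[0,1]` into `n + 1` cells. -/
noncomputable def node (n j : ℕ) : ℝ := j / (n + 1)

/-- The jump at `node n (i + 1)` of the slope of the piecewise linear interpolation of `h`. -/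
noncomputable def slopeJump (h : ℝ → ℝ) (n i : ℕ) : ℝ :=
  (n + 1) * (h (node n (i + 2)) - 2 * h (node n (i + 1)) + h (node n i))

/-- The piecewise linear interpolation of `h` at the nodes `node n j`, written as a combination of
hinges. The constant term is left out, so this interpolates `h` only if `h 0 = 0`. -/
noncomputable def interp (h : ℝ → ℝ) (n : ℕ) (s : ℝ) : ℝ :=
  (n + 1) * h (node n 1) * s + ∑ i ∈ Finset.range n, slopeJump h n i * hinge (node n (i + 1)) s

variable {h : ℝ → ℝ} {n : ℕ}

lemma node_mem_Icc {j : ℕ} (hj : j ≤ n + 1) : node n j ∈ Icc (0 : ℝ) 1 :=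
  ⟨by rw [node]; positivity, div_le_one_of_le₀ (by exact_mod_cast hj) (by positivity)⟩

lemma node_succ_mem_Ioo {i : ℕ} (hi : i < n) : node n (i + 1) ∈ Ioo (0 : ℝ) 1 :=
  ⟨by rw [node]; positivity,
    (div_lt_one (by positivity)).2 (by exact_mod_cast Nat.succ_lt_succ hi)⟩

lemma lineMap_node (n j : ℕ) (t : ℝ) :
    (1 - t) * node n j + t * node n (j + 1) = (j + t) / (n + 1) := by
  simp only [node, Nat.cast_add, Nat.cast_one]
  ring

lemma exists_lineMap_node_eq (n : ℕ) {s : ℝ} (hs : s ∈ Icc (0 : ℝ) 1) :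
    ∃ j ≤ n, ∃ t ∈ Icc (0 : ℝ) 1, (1 - t) * node n j + t * node n (j + 1) = s := by
  have hN : (0 : ℝ) < n + 1 := by positivity
  simp only [lineMap_node, div_eq_iff hN.ne']
  rcases hs.2.eq_or_lt with rfl | hs1
  · exact ⟨n, le_rfl, 1, right_mem_Icc.2 zero_le_one, (one_mul _).symm⟩
  · have hlt : s * (n + 1) < (n + 1 : ℕ) := by
      push_cast
      exact mul_lt_of_lt_one_left hN hs1
    have hfract := Nat.floor_le (mul_nonneg hs.1 hN.le)
    have hfloor := Nat.lt_floor_add_one (s * (n + 1))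
    exact ⟨⌊s * (n + 1)⌋₊, Nat.lt_succ_iff.1 ((Nat.floor_lt' n.succ_ne_zero).2 hlt),
      s * (n + 1) - ⌊s * (n + 1)⌋₊, ⟨by linarith, by linarith⟩, by ring⟩

lemma sum_second_difference_mul (f : ℕ → ℝ) (m : ℕ) (y : ℝ) :
    f 0 + (f 1 - f 0) * y
        + ∑ i ∈ Finset.range m, (f (i + 2) - 2 * f (i + 1) + f i) * (y - (i + 1)) =
      f m + (f (m + 1) - f m) * (y - m) := by
  induction m with
  | zero => simp
  | succ m ih =>
    rw [Finset.sum_range_succ, ← add_assoc, ih]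
    push_cast
    ring

lemma sum_slopeJump_mul_hinge {j : ℕ} (hj : j ≤ n) {t : ℝ} (ht : t ∈ Icc (0 : ℝ) 1) :
    ∑ i ∈ Finset.range n, slopeJump h n i * hinge (node n (i + 1)) ((j + t) / (n + 1)) =
      ∑ i ∈ Finset.range j, (h (node n (i + 2)) - 2 * h (node n (i + 1)) + h (node n i)) *
        (j + t - (i + 1)) := by
  rw [← Finset.sum_subset (Finset.range_subset_range.2 hj)]
  · refine Finset.sum_congr rfl fun i hi => ?_
    have hij : (i : ℝ) + 1 ≤ j := by exact_mod_cast Finset.mem_range.1 hi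
    have hle : node n (i + 1) ≤ (j + t) / (n + 1) := by
      rw [node]
      push_cast
      gcongr ?_ / _
      linarith [ht.1]
    have hscale : (n + 1) * ((j + t) / (n + 1) - node n (i + 1)) = j + t - (i + 1) := by
      rw [node]
      push_cast
      field_simp
    rw [hinge_of_le hle, slopeJump, mul_right_comm, hscale, mul_comm]
  · intro i _ hi
    have hji : (j : ℝ) ≤ i := by exact_mod_cast not_lt.1 (mt Finset.mem_range.2 hi)
    have hle : (j + t) / (n + 1) ≤ node n (i + 1) := by
      rw [node]
      push_cast
      gcongr ?_ / _
      linarith [ht.2]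
    rw [hinge_of_ge hle, mul_zero]

lemma interp_lineMap_node (h0 : h 0 = 0) {j : ℕ} (hj : j ≤ n) {t : ℝ} (ht : t ∈ Icc (0 : ℝ) 1) :
    interp h n ((1 - t) * node n j + t * node n (j + 1)) =
      (1 - t) * h (node n j) + t * h (node n (j + 1)) := by
  have hsum := sum_second_difference_mul (fun i => h (node n i)) j (j + t)
  have hnode0 : h (node n 0) = 0 := by simp [node, h0]
  have hslope : (n + 1) * h (node n 1) * ((j + t) / (n + 1)) = h (node n 1) * (j + t) := by
    field_simp
  simp only [hnode0] at hsum
  rw [lineMap_node, interp, sum_slopeJump_mul_hinge hj ht, hslope]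
  linarith

lemma le_interp (hconv : ConvexOn ℝ (Icc 0 1) h) (h0 : h 0 = 0) (n : ℕ) {s : ℝ}
    (hs : s ∈ Icc (0 : ℝ) 1) : h s ≤ interp h n s := by
  obtain ⟨j, hj, t, ht, rfl⟩ := exists_lineMap_node_eq n hs
  rw [interp_lineMap_node h0 hj ht]
  exact hconv.2 (node_mem_Icc (by lia)) (node_mem_Icc (by lia)) (sub_nonneg.2 ht.2) ht.1
    (sub_add_cancel 1 t)

lemma le_chord (hconv : ConvexOn ℝ (Icc 0 1) h) (h0 : h 0 = 0) {s : ℝ}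
    (hs : s ∈ Icc (0 : ℝ) 1) : h s ≤ h 1 * s := by
  have hle := hconv.2 (left_mem_Icc.2 zero_le_one) (right_mem_Icc.2 zero_le_one)
    (sub_nonneg.2 hs.2) hs.1 (sub_add_cancel 1 s)
  simpa only [smul_eq_mul, mul_zero, mul_one, zero_add, one_mul, h0, mul_comm s] using hle

lemma interp_le_chord (hconv : ConvexOn ℝ (Icc 0 1) h) (h0 : h 0 = 0) (n : ℕ) {s : ℝ}
    (hs : s ∈ Icc (0 : ℝ) 1) : interp h n s ≤ h 1 * s := by
  obtain ⟨j, hj, t, ht, rfl⟩ := exists_lineMap_node_eq n hs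
  calc interp h n ((1 - t) * node n j + t * node n (j + 1))
      = (1 - t) * h (node n j) + t * h (node n (j + 1)) := interp_lineMap_node h0 hj ht
    _ ≤ (1 - t) * (h 1 * node n j) + t * (h 1 * node n (j + 1)) :=
        add_le_add
          (mul_le_mul_of_nonneg_left (le_chord hconv h0 (node_mem_Icc (by lia)))
            (sub_nonneg.2 ht.2))
          (mul_le_mul_of_nonneg_left (le_chord hconv h0 (node_mem_Icc (by lia))) ht.1)
    _ = h 1 * ((1 - t) * node n j + t * node n (j + 1)) := by ring

lemma tendsto_interp (hcont : ContinuousOn h (Icc 0 1)) (h0 : h 0 = 0) {s : ℝ}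
    (hs : s ∈ Icc (0 : ℝ) 1) : Tendsto (fun n => interp h n s) atTop (𝓝 (h s)) := by
  rw [Metric.tendsto_atTop]
  intro ε hε
  obtain ⟨δ, hδ, hball⟩ := Metric.continuousOn_iff.1 hcont s hs ε hε
  obtain ⟨m, hm⟩ := exists_nat_one_div_lt hδ
  refine ⟨m, fun n hn => ?_⟩
  have hmesh : 1 / ((n : ℝ) + 1) < δ := (Nat.one_div_le_one_div hn).trans_lt hm
  obtain ⟨j, hj, t, ht, rfl⟩ := exists_lineMap_node_eq n hs
  have hwidth : node n (j + 1) = node n j + 1 / (n + 1) := by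
    simp only [node, Nat.cast_add, Nat.cast_one, add_div]
  have hw : 0 < 1 / ((n : ℝ) + 1) := Nat.one_div_pos_of_nat
  have hleft : dist (node n j) ((1 - t) * node n j + t * node n (j + 1)) < δ := by
    rw [hwidth, Real.dist_eq, abs_lt]
    constructor <;> nlinarith [ht.1, ht.2]
  have hright : dist (node n (j + 1)) ((1 - t) * node n j + t * node n (j + 1)) < δ := by
    rw [hwidth, Real.dist_eq, abs_lt]
    constructor <;> nlinarith [ht.1, ht.2]
  rw [interp_lineMap_node h0 hj ht]
  exact (convex_ball _ ε) (hball _ (node_mem_Icc (by lia)) hleft)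
    (hball _ (node_mem_Icc (by lia)) hright) (sub_nonneg.2 ht.2) ht.1 (sub_add_cancel 1 t)

lemma slopeJump_nonneg (hconv : ConvexOn ℝ (Icc 0 1) h) {i : ℕ} (hi : i < n) :
    0 ≤ slopeJump h n i := by
  have hmid := hconv.2 (node_mem_Icc (n := n) (j := i) (by lia))
    (node_mem_Icc (n := n) (j := i + 2) (by lia)) one_half_pos.le one_half_pos.le (add_halves 1)
  have hnode : (1 / 2 : ℝ) • node n i + (1 / 2 : ℝ) • node n (i + 2) = node n (i + 1) := by
    simp only [node, smul_eq_mul]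
    push_cast
    ring
  rw [hnode] at hmid
  simp only [smul_eq_mul] at hmid
  exact mul_nonneg (by positivity) (by linarith)

variable {μ : Measure ℝ} [IsProbabilityMeasure μ]

lemma hasFiniteChoquet_slopeJump_mul_hinge (hμ : Integrable (fun x => x) μ) (h : ℝ → ℝ) {i : ℕ}
    (hi : i ∈ Finset.range n) :
    HasFiniteChoquet (fun s => slopeJump h n i * hinge (node n (i + 1)) s) μ :=
  (hasFiniteChoquet_of_lipschitzWith hμ (lipschitzWith_hinge _)
    (hinge_of_ge (node_succ_mem_Ioo (Finset.mem_range.1 hi)).1.le)).const_mul _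

lemma hasFiniteChoquet_interp (hμ : Integrable (fun x => x) μ) (h : ℝ → ℝ) (n : ℕ) :
    HasFiniteChoquet (interp h n) μ :=
  ((hasFiniteChoquet_id hμ).const_mul _).add <| HasFiniteChoquet.sum fun _ =>
    hasFiniteChoquet_slopeJump_mul_hinge hμ h

lemma choquet_interp (hμ : Integrable (fun x => x) μ) (h : ℝ → ℝ) (n : ℕ) :
    choquet (interp h n) μ = (n + 1) * h (node n 1) * ∫ x, x ∂μ +
      ∑ i ∈ Finset.range n, slopeJump h n i * choquet (hinge (node n (i + 1))) μ := by
  have hfin := fun i => hasFiniteChoquet_slopeJump_mul_hinge (n := n) (i := i) hμ h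
  simp only [← choquet_id hμ, ← choquet_const_mul, ← choquet_sum hfin]
  exact choquet_add ((hasFiniteChoquet_id hμ).const_mul _) (HasFiniteChoquet.sum hfin)

lemma tendsto_choquet_interp (hconv : ConvexOn ℝ (Icc 0 1) h) (hcont : ContinuousOn h (Icc 0 1))
    (h0 : h 0 = 0) (hμ : Integrable (fun x => x) μ) (hfin : HasFiniteChoquet h μ) :
    Tendsto (fun n => choquet (interp h n) μ) atTop (𝓝 (choquet h μ)) :=
  tendsto_choquet hfin ((hasFiniteChoquet_id hμ).const_mul (h 1))
    (fun n => hasFiniteChoquet_interp hμ h n) hfin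
    (fun n _ hs => le_interp hconv h0 n hs) (fun n _ hs => interp_le_chord hconv h0 n hs)
    (mul_one _).symm (fun _ hs => tendsto_interp hcont h0 hs)

end Interpolation

section ConvexDistortion

variable {h : ℝ → ℝ} {μ ν : Measure ℝ}

lemma ConcaveOrderLE.integral_eq (hle : ConcaveOrderLE μ ν) (hμ : Integrable (fun x => x) μ) :
    ∫ x, x ∂μ = ∫ x, x ∂ν := by
  have hneg := (hle _ (convexOn_id convex_univ).neg hμ.neg).2
  simp only [Pi.neg_apply, id] at hneg
  rw [integral_neg, integral_neg, neg_le_neg_iff] at hneg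
  exact le_antisymm (hle _ (concaveOn_id convex_univ) hμ).2 hneg

variable [IsProbabilityMeasure μ] [IsProbabilityMeasure ν]

/- `∫ x, x ∂μ` and the values at hinges span the values at all interpolations of `h`, with
nonnegative coefficients at the hinges. -/
lemma mul_choquet_add_le_of_hinge {μ₁ μ₂ : Measure ℝ} [IsProbabilityMeasure μ₁]
    [IsProbabilityMeasure μ₂] (hconv : ConvexOn ℝ (Icc 0 1) h)
    (hcont : ContinuousOn h (Icc 0 1)) (h0 : h 0 = 0) (hμ₁ : Integrable (fun x => x) μ₁)
    (hμ₂ : Integrable (fun x => x) μ₂) (hν : Integrable (fun x => x) ν)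
    (hfμ₁ : HasFiniteChoquet h μ₁) (hfμ₂ : HasFiniteChoquet h μ₂) (hfν : HasFiniteChoquet h ν)
    {a b : ℝ} (hmean : a * ∫ x, x ∂μ₁ + b * ∫ x, x ∂μ₂ = ∫ x, x ∂ν)
    (hhinge : ∀ k ∈ Ioo (0 : ℝ) 1,
      a * choquet (hinge k) μ₁ + b * choquet (hinge k) μ₂ ≤ choquet (hinge k) ν) :
    a * choquet h μ₁ + b * choquet h μ₂ ≤ choquet h ν := by
  refine le_of_tendsto_of_tendsto'
    (((tendsto_choquet_interp hconv hcont h0 hμ₁ hfμ₁).const_mul a).add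
      ((tendsto_choquet_interp hconv hcont h0 hμ₂ hfμ₂).const_mul b))
    (tendsto_choquet_interp hconv hcont h0 hν hfν) fun n => ?_
  simp only [choquet_interp hμ₁, choquet_interp hμ₂, choquet_interp hν, ← hmean, mul_add,
    Finset.mul_sum]
  rw [add_add_add_comm, ← Finset.sum_add_distrib]
  refine add_le_add (by linarith) (Finset.sum_le_sum fun i hi => ?_)
  have hi := Finset.mem_range.1 hi
  have hle := mul_le_mul_of_nonneg_left (hhinge _ (node_succ_mem_Ioo hi))
    (slopeJump_nonneg hconv hi)
  linarith

lemma convexOn_posPart_sub (y : ℝ) : ConvexOn ℝ univ fun x : ℝ => max (y - x) 0 :=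
  ((convexOn_const y convex_univ).sub (concaveOn_id convex_univ)).sup
    (convexOn_const 0 convex_univ)

lemma choquet_hinge_le_of_concaveOrderLE (hle : ConcaveOrderLE μ ν)
    (hμ : Integrable (fun x => x) μ) (hν : Integrable (fun x => x) ν) {k : ℝ}
    (hk : k ∈ Ioo (0 : ℝ) 1) : choquet (hinge k) μ ≤ choquet (hinge k) ν := by
  obtain ⟨y, hy⟩ := (isGreatest_choquet_hinge hμ hk).1
  have hloss := (hle _ (convexOn_posPart_sub y).neg (integrable_posPart_sub hμ y).neg).2
  simp only [Pi.neg_apply, integral_neg, neg_le_neg_iff] at hloss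
  calc choquet (hinge k) μ = (1 - k) * y - ∫ x, max (y - x) 0 ∂μ := hy.symm
    _ ≤ (1 - k) * y - ∫ x, max (y - x) 0 ∂ν := sub_le_sub_left hloss _
    _ ≤ choquet (hinge k) ν := (isGreatest_choquet_hinge hν hk).2 ⟨y, rfl⟩

theorem choquet_le_of_concaveOrderLE (hconv : ConvexOn ℝ (Icc 0 1) h)
    (hcont : ContinuousOn h (Icc 0 1)) (h0 : h 0 = 0) (hμ : Integrable (fun x => x) μ)
    (hν : Integrable (fun x => x) ν) (hfμ : HasFiniteChoquet h μ) (hfν : HasFiniteChoquet h ν)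
    (hle : ConcaveOrderLE μ ν) : choquet h μ ≤ choquet h ν := by
  simpa only [one_mul, zero_mul, add_zero] using
    mul_choquet_add_le_of_hinge (a := 1) (b := 0) hconv hcont h0 hμ hμ hν hfμ hfμ hfν
      (by simpa only [one_mul, zero_mul, add_zero] using hle.integral_eq hμ) fun k hk => by
        simpa only [one_mul, zero_mul, add_zero] using
          choquet_hinge_le_of_concaveOrderLE hle hμ hν hk

end ConvexDistortion

section Superlinear

variable {Ω : Type*} [MeasurableSpace Ω] {P : Measure Ω} {X Y : Ω → ℝ} {a b : ℝ}

lemma integral_id_map (hX : AEMeasurable X P) : ∫ x, x ∂(P.map X) = ∫ ω, X ω ∂P :=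
  integral_map hX aestronglyMeasurable_id

lemma integrable_id_map (hX : Integrable X P) : Integrable (fun x => x) (P.map X) :=
  (integrable_map_measure aestronglyMeasurable_id hX.aemeasurable).2 hX

lemma integral_posPart_sub_map (hX : AEMeasurable X P) (y : ℝ) :
    ∫ x, max (y - x) 0 ∂(P.map X) = ∫ ω, max (y - X ω) 0 ∂P :=
  integral_map hX
    ((continuous_const.sub continuous_id).max continuous_const).aestronglyMeasurable

variable [IsProbabilityMeasure P]

lemma integral_posPart_sub_comb_le (hX : Integrable X P) (hY : Integrable Y P) (ha : 0 ≤ a)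
    (hb : 0 ≤ b) (y z : ℝ) :
    ∫ ω, max (a * y + b * z - (a * X ω + b * Y ω)) 0 ∂P ≤
      a * ∫ ω, max (y - X ω) 0 ∂P + b * ∫ ω, max (z - Y ω) 0 ∂P := by
  have hinteg {Z : Ω → ℝ} (hZ : Integrable Z P) (c : ℝ) : Integrable (fun ω => max (c - Z ω) 0) P :=
    ((integrable_const c).sub hZ).sup (integrable_const 0)
  rw [← integral_const_mul, ← integral_const_mul,
    ← integral_add ((hinteg hX y).const_mul a) ((hinteg hY z).const_mul b)]
  refine integral_mono (hinteg ((hX.const_mul a).add (hY.const_mul b)) _)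
    (((hinteg hX y).const_mul a).add ((hinteg hY z).const_mul b)) fun ω => max_le ?_ (by positivity)
  calc a * y + b * z - (a * X ω + b * Y ω) = a * (y - X ω) + b * (z - Y ω) := by ring
    _ ≤ a * max (y - X ω) 0 + b * max (z - Y ω) 0 :=
        add_le_add (mul_le_mul_of_nonneg_left (le_max_left _ _) ha)
          (mul_le_mul_of_nonneg_left (le_max_left _ _) hb)

lemma choquet_hinge_superlinear (hX : Integrable X P) (hY : Integrable Y P) (ha : 0 ≤ a)
    (hb : 0 ≤ b) {k : ℝ} (hk : k ∈ Ioo (0 : ℝ) 1) :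
    a * choquet (hinge k) (P.map X) + b * choquet (hinge k) (P.map Y) ≤
      choquet (hinge k) (P.map fun ω => a * X ω + b * Y ω) := by
  have hZ : Integrable (fun ω => a * X ω + b * Y ω) P := (hX.const_mul a).add (hY.const_mul b)
  have := Measure.isProbabilityMeasure_map hX.aemeasurable
  have := Measure.isProbabilityMeasure_map hY.aemeasurable
  have := Measure.isProbabilityMeasure_map hZ.aemeasurable
  obtain ⟨y, hy⟩ := (isGreatest_choquet_hinge (integrable_id_map hX) hk).1
  obtain ⟨z, hz⟩ := (isGreatest_choquet_hinge (integrable_id_map hY) hk).1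
  have hmax := (isGreatest_choquet_hinge (integrable_id_map hZ) hk).2 ⟨a * y + b * z, rfl⟩
  have hloss := integral_posPart_sub_comb_le hX hY ha hb y z
  simp only [integral_posPart_sub_map hX.aemeasurable, integral_posPart_sub_map hY.aemeasurable,
    integral_posPart_sub_map hZ.aemeasurable] at hy hz hmax
  rw [← hy, ← hz]
  linarith

theorem choquet_superlinear {h : ℝ → ℝ} (hconv : ConvexOn ℝ (Icc 0 1) h)
    (hcont : ContinuousOn h (Icc 0 1)) (h0 : h 0 = 0) (hX : Integrable X P) (hY : Integrable Y P)
    (hfX : HasFiniteChoquet h (P.map X)) (hfY : HasFiniteChoquet h (P.map Y))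
    (hfZ : HasFiniteChoquet h (P.map fun ω => a * X ω + b * Y ω)) (ha : 0 ≤ a) (hb : 0 ≤ b) :
    a * choquet h (P.map X) + b * choquet h (P.map Y) ≤
      choquet h (P.map fun ω => a * X ω + b * Y ω) := by
  have hZ : Integrable (fun ω => a * X ω + b * Y ω) P := (hX.const_mul a).add (hY.const_mul b)
  have := Measure.isProbabilityMeasure_map hX.aemeasurable
  have := Measure.isProbabilityMeasure_map hY.aemeasurable
  have := Measure.isProbabilityMeasure_map hZ.aemeasurable
  refine mul_choquet_add_le_of_hinge hconv hcont h0 (integrable_id_map hX)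
    (integrable_id_map hY) (integrable_id_map hZ) hfX hfY hfZ ?_
    fun k hk => choquet_hinge_superlinear hX hY ha hb hk
  rw [integral_id_map hX.aemeasurable, integral_id_map hY.aemeasurable,
    integral_id_map hZ.aemeasurable, integral_add (hX.const_mul a) (hY.const_mul b),
    integral_const_mul, integral_const_mul]

end Superlinear

section Concave

variable {Ω : Type*} [MeasurableSpace Ω] {P : Measure Ω} [IsFiniteMeasure P] {f : ℝ → ℝ}
  {X Y : Ω → ℝ} {a b : ℝ}

/- Concavity bounds the composition below, an affine majorant of `f` bounds it above. -/
lemma integrable_comp_convexComb (hf : ConcaveOn ℝ univ f) (hX : Integrable X P)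
    (hY : Integrable Y P) (hfX : Integrable (fun ω => f (X ω)) P)
    (hfY : Integrable (fun ω => f (Y ω)) P) (ha : 0 ≤ a) (hb : 0 ≤ b) (hab : a + b = 1) :
    Integrable (fun ω => f (a * X ω + b * Y ω)) P := by
  have hcont : Continuous f := continuousOn_univ.1 (hf.continuousOn isOpen_univ)
  have hZ : Integrable (fun ω => a * X ω + b * Y ω) P := (hX.const_mul a).add (hY.const_mul b)
  obtain ⟨c, d, hmajorant⟩ := hf.neg.exists_affine_le_real isClosed_univ
    (hcont.neg.lowerSemicontinuous.lowerSemicontinuousOn univ)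
  exact integrable_of_le_of_le
    (hcont.measurable.comp_aemeasurable hZ.aemeasurable).aestronglyMeasurable
    (ae_of_all _ fun _ => hf.2 (mem_univ _) (mem_univ _) ha hb hab)
    (ae_of_all _ fun _ => le_neg_of_le_neg (hmajorant _ (mem_univ _)))
    ((hfX.const_mul a).add (hfY.const_mul b)) ((hZ.const_mul c).add (integrable_const d)).neg

lemma le_integral_comp_convexComb (hf : ConcaveOn ℝ univ f) (hX : Integrable X P)
    (hY : Integrable Y P) (hfX : Integrable (fun ω => f (X ω)) P)
    (hfY : Integrable (fun ω => f (Y ω)) P) (ha : 0 ≤ a) (hb : 0 ≤ b) (hab : a + b = 1) :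
    a * ∫ ω, f (X ω) ∂P + b * ∫ ω, f (Y ω) ∂P ≤ ∫ ω, f (a * X ω + b * Y ω) ∂P := by
  rw [← integral_const_mul, ← integral_const_mul,
    ← integral_add (hfX.const_mul a) (hfY.const_mul b)]
  exact integral_mono ((hfX.const_mul a).add (hfY.const_mul b))
    (integrable_comp_convexComb hf hX hY hfX hfY ha hb hab)
    fun _ => hf.2 (mem_univ _) (mem_univ _) ha hb hab

end Concave

section Law

variable {Ω : Type*} [MeasurableSpace Ω] {P : Measure Ω} {q : ℝ≥0∞}

lemma aemeasurable_coeFn_Lp (X : Lp ℝ q P) : AEMeasurable X P :=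
  (Lp.aestronglyMeasurable X).aemeasurable

lemma law_smul_add_smul (a b : ℝ) (X Y : Lp ℝ q P) :
    law (a • X + b • Y) = P.map fun ω => a * X ω + b * Y ω := by
  refine Measure.map_congr ?_
  filter_upwards [Lp.coeFn_add (a • X) (b • Y), Lp.coeFn_smul a X, Lp.coeFn_smul b Y]
    with ω hadd hX hY
  rw [hadd, Pi.add_apply, hX, hY]
  rfl

lemma memLp_id_law (X : Lp ℝ q P) : MemLp (fun x => x) q (law X) :=
  (memLp_map_measure_iff aestronglyMeasurable_id (aemeasurable_coeFn_Lp X)).2 (Lp.memLp X)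

lemma memLp_mixture (hq0 : q ≠ 0) (hq : q ≠ ∞) {μ ν : Measure ℝ} (t : ℝ)
    (hμ : MemLp (fun x => x) q μ) (hν : MemLp (fun x => x) q ν) :
    MemLp (fun x => x) q (mixture t μ ν) := by
  have hmeas (ρ : Measure ℝ) : AEStronglyMeasurable (fun x : ℝ => x) ρ := aestronglyMeasurable_id
  rw [← integrable_norm_rpow_iff (hmeas _) hq0 hq] at hμ hν ⊢
  exact (hμ.smul_measure ENNReal.ofReal_ne_top).add_measure
    (hν.smul_measure ENNReal.ofReal_ne_top)

variable [IsProbabilityMeasure P]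

instance isProbabilityMeasure_law (X : Lp ℝ q P) : IsProbabilityMeasure (law X) :=
  Measure.isProbabilityMeasure_map (aemeasurable_coeFn_Lp X)

lemma map_zero_of_hasFiniteChoquet_law {h : ℝ → ℝ}
    (hh : HasFiniteChoquet h (law (0 : Lp ℝ q P))) : h 0 = 0 := by
  have hlaw : law (0 : Lp ℝ q P) = Measure.dirac 0 := by
    rw [law, Measure.map_congr (Lp.coeFn_zero ℝ q P)]
    exact (Measure.map_const P 0).trans (by rw [measure_univ, one_smul])
  rw [hlaw] at hh
  refine hh.map_zero (b := 0) fun x hx => ?_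
  have hcdf := one_sub_cdf_dirac 0 x
  rwa [indicator_of_notMem (notMem_Iio.2 hx.le), sub_eq_zero, eq_comm] at hcdf

variable [Fact (1 ≤ q)]

lemma integrable_id_law (X : Lp ℝ q P) : Integrable (fun x => x) (law X) :=
  (memLp_id_law X).integrable Fact.out

lemma choquet_law_superlinear {h : ℝ → ℝ} (hconv : ConvexOn ℝ (Icc 0 1) h)
    (hcont : ContinuousOn h (Icc 0 1)) (hfin : ∀ X : Lp ℝ q P, HasFiniteChoquet h (law X))
    {a b : ℝ} (ha : 0 ≤ a) (hb : 0 ≤ b) (X Y : Lp ℝ q P) :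
    a * choquet h (law X) + b * choquet h (law Y) ≤ choquet h (law (a • X + b • Y)) := by
  have hfZ := hfin (a • X + b • Y)
  rw [law_smul_add_smul] at hfZ ⊢
  exact choquet_superlinear hconv hcont (map_zero_of_hasFiniteChoquet_law (hfin 0))
    ((Lp.memLp X).integrable Fact.out) ((Lp.memLp Y).integrable Fact.out) (hfin X) (hfin Y) hfZ
    ha hb

lemma concaveOrderLE_law_convexComb {X Y : Lp ℝ q P} (hXY : law X = law Y) {a b : ℝ}
    (ha : 0 ≤ a) (hb : 0 ≤ b) (hab : a + b = 1) :
    ConcaveOrderLE (law X) (law (a • X + b • Y)) := by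
  intro f hf hfX
  have hfm (ρ : Measure ℝ) : AEStronglyMeasurable f ρ :=
    (continuousOn_univ.1 (hf.continuousOn isOpen_univ)).aestronglyMeasurable
  have hX := (Lp.memLp X).integrable Fact.out
  have hY := (Lp.memLp Y).integrable Fact.out
  have hfX' := hfX.comp_aemeasurable (aemeasurable_coeFn_Lp X)
  have hfY' := (hXY ▸ hfX : Integrable f (law Y)).comp_aemeasurable (aemeasurable_coeFn_Lp Y)
  have hZ : AEMeasurable (fun ω => a * X ω + b * Y ω) P :=
    ((hX.const_mul a).add (hY.const_mul b)).aemeasurable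
  have hlawX : ∫ x, f x ∂(law X) = ∫ ω, f (X ω) ∂P :=
    integral_map (aemeasurable_coeFn_Lp X) (hfm _)
  have hlawY : ∫ x, f x ∂(law X) = ∫ ω, f (Y ω) ∂P :=
    hXY ▸ integral_map (aemeasurable_coeFn_Lp Y) (hfm _)
  rw [law_smul_add_smul, integrable_map_measure (hfm _) hZ, integral_map hZ (hfm _)]
  refine ⟨integrable_comp_convexComb hf hX hY hfX' hfY' ha hb hab, ?_⟩
  calc ∫ x, f x ∂(law X) = a * ∫ ω, f (X ω) ∂P + b * ∫ ω, f (Y ω) ∂P := by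
        rw [← hlawX, ← hlawY, ← add_mul, hab, one_mul]
    _ ≤ ∫ ω, f (a * X ω + b * Y ω) ∂P := le_integral_comp_convexComb hf hX hY hfX' hfY' ha hb hab

end Law

section StepLaws

/-- The function `x ↦ ℙ(x < Z)` of a random variable `Z` with values in `{0, d₁, d₁ + d₂}`, where
`s₁ = ℙ(d₁ ≤ Z)` and `s₂ = ℙ(d₁ + d₂ ≤ Z)`. -/
noncomputable def stepSurvival (d₁ d₂ s₁ s₂ x : ℝ) : ℝ :=
  if x < 0 then 1 else if x < d₁ then s₁ else if x < d₁ + d₂ then s₂ else 0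

lemma choquet_of_stepSurvival {h : ℝ → ℝ} (h0 : h 0 = 0) {μ : Measure ℝ} {d₁ d₂ s₁ s₂ : ℝ}
    (hd₁ : 0 ≤ d₁) (hd₂ : 0 ≤ d₂) (hμ : ∀ x, 1 - cdf μ x = stepSurvival d₁ d₂ s₁ s₂ x) :
    choquet h μ = d₁ * h s₁ + d₂ * h s₂ := by
  have hinteg (a b c : ℝ) : Integrable ((Ico a b).indicator fun _ => c) :=
    (integrable_indicator_iff measurableSet_Ico).2 (integrableOn_const measure_Ico_lt_top.ne)
  have hI : choquetIntegrand h μ = fun x =>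
      (Ico 0 d₁).indicator (fun _ => h s₁) x + (Ico d₁ (d₁ + d₂)).indicator (fun _ => h s₂) x := by
    funext x
    simp only [choquetIntegrand, hμ, stepSurvival, indicator, mem_Iio, mem_Ico]
    grind
  have hfin : HasFiniteChoquet h μ :=
    hasFiniteChoquet_iff_integrable.2 (hI ▸ (hinteg _ _ _).add (hinteg _ _ _))
  rw [choquet_eq_integral hfin, hI, integral_add (hinteg _ _ _) (hinteg _ _ _),
    integral_indicator_const _ measurableSet_Ico,
    integral_indicator_const _ measurableSet_Ico, Real.volume_real_Ico_of_le hd₁,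
    Real.volume_real_Ico_of_le (le_add_of_nonneg_right hd₂), sub_zero, add_sub_cancel_left,
    smul_eq_mul, smul_eq_mul]

lemma one_sub_cdf_mixture_of_stepSurvival {μ ν : Measure ℝ} [IsProbabilityMeasure μ]
    [IsProbabilityMeasure ν] {d₁ d₂ s₁ s₂ t₁ t₂ r : ℝ} (hr : r ∈ Icc (0 : ℝ) 1)
    (hμ : ∀ x, 1 - cdf μ x = stepSurvival d₁ d₂ s₁ s₂ x)
    (hν : ∀ x, 1 - cdf ν x = stepSurvival d₁ d₂ t₁ t₂ x) (x : ℝ) :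
    1 - cdf (mixture r μ ν) x =
      stepSurvival d₁ d₂ (r * s₁ + (1 - r) * t₁) (r * s₂ + (1 - r) * t₂) x := by
  have hx : 1 - cdf (mixture r μ ν) x = r * (1 - cdf μ x) + (1 - r) * (1 - cdf ν x) := by
    rw [cdf_mixture hr]
    ring
  rw [hx, hμ, hν]
  unfold stepSurvival
  split_ifs <;> ring

end StepLaws

section EventIndicators

variable {Ω : Type*} [MeasurableSpace Ω] {P : Measure Ω} [IsFiniteMeasure P] {q : ℝ≥0∞}
  {A M N : Set Ω}

/-- The indicator function of the event `A` as an element of `L^q`. -/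
noncomputable def eventLp (P : Measure Ω) [IsFiniteMeasure P] (q : ℝ≥0∞) {A : Set Ω}
    (hA : MeasurableSet A) : Lp ℝ q P :=
  indicatorConstLp q hA (measure_ne_top P A) 1

lemma coeFn_eventLp (hA : MeasurableSet A) : eventLp P q hA =ᵐ[P] A.indicator 1 :=
  indicatorConstLp_coeFn

lemma eventLp_add (hM : MeasurableSet M) (hN : MeasurableSet N) :
    eventLp P q hM + eventLp P q hN = eventLp P q (hM.union hN) + eventLp P q (hM.inter hN) := by
  refine Lp.ext ?_
  filter_upwards [Lp.coeFn_add (eventLp P q hM) (eventLp P q hN),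
    Lp.coeFn_add (eventLp P q (hM.union hN)) (eventLp P q (hM.inter hN)), coeFn_eventLp hM,
    coeFn_eventLp hN, coeFn_eventLp (hM.union hN), coeFn_eventLp (hM.inter hN)]
    with ω hsum hsum' hωM hωN hunion hinter
  rw [hsum, hsum', Pi.add_apply, Pi.add_apply, hωM, hωN, hunion, hinter]
  exact congrFun (indicator_union_add_inter 1 M N).symm ω

end EventIndicators

section EventLaws

variable {Ω : Type*} [MeasurableSpace Ω] {P : Measure Ω} [IsProbabilityMeasure P] {q : ℝ≥0∞}
  {A B M N : Set Ω}

lemma one_sub_cdf_law_smul_eventLp_add (hA : MeasurableSet A) (hB : MeasurableSet B) (hBA : B ⊆ A)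
    {d₁ d₂ : ℝ} (hd₁ : 0 ≤ d₁) (hd₂ : 0 ≤ d₂) (x : ℝ) :
    1 - cdf (law (d₁ • eventLp P q hA + d₂ • eventLp P q hB)) x =
      stepSurvival d₁ d₂ (P.real A) (P.real B) x := by
  set Z : Ω → ℝ := fun ω => d₁ * A.indicator 1 ω + d₂ * B.indicator 1 ω with hZ
  have hZm : Measurable Z := ((measurable_one.indicator hA).const_mul d₁).add
    ((measurable_one.indicator hB).const_mul d₂)
  have hlaw : law (d₁ • eventLp P q hA + d₂ • eventLp P q hB) = P.map Z := by
    rw [law_smul_add_smul]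
    refine Measure.map_congr ?_
    filter_upwards [coeFn_eventLp (P := P) (q := q) hA, coeFn_eventLp (P := P) (q := q) hB]
      with ω hωA hωB
    rw [hωA, hωB]
  have := Measure.isProbabilityMeasure_map (μ := P) hZm.aemeasurable
  have hset : Z ⁻¹' Ioi x =
      if x < 0 then univ else if x < d₁ then A else if x < d₁ + d₂ then B else ∅ := by
    ext ω
    have hmem := @hBA ω
    by_cases hωA : ω ∈ A <;> by_cases hωB : ω ∈ B <;>
      simp only [hZ, mem_preimage, mem_Ioi, indicator, Pi.one_apply, hωA, hωB, if_true,
        if_false] <;>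
      grind
  rw [hlaw, cdf_eq_real, ← probReal_compl_eq_one_sub measurableSet_Iic, compl_Iic,
    map_measureReal_apply hZm measurableSet_Ioi, hset]
  unfold stepSurvival
  split_ifs <;> simp

lemma one_sub_cdf_law_eventLp (hA : MeasurableSet A) (x : ℝ) :
    1 - cdf (law (eventLp P q hA)) x = stepSurvival 1 0 (P.real A) (P.real A) x := by
  rw [← one_sub_cdf_law_smul_eventLp_add (q := q) hA hA subset_rfl zero_le_one le_rfl, one_smul,
    zero_smul, add_zero]

lemma law_eventLp_congr (hM : MeasurableSet M) (hN : MeasurableSet N) (hMN : P.real M = P.real N) :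
    law (eventLp P q hM) = law (eventLp P q hN) := by
  refine Measure.eq_of_cdf _ _ (StieltjesFunction.ext fun x => ?_)
  rw [← sub_right_inj (a := (1 : ℝ)), one_sub_cdf_law_eventLp, one_sub_cdf_law_eventLp, hMN]

variable {h : ℝ → ℝ}

lemma choquet_law_eventLp (h0 : h 0 = 0) (hA : MeasurableSet A) :
    choquet h (law (eventLp P q hA)) = h (P.real A) := by
  rw [choquet_of_stepSurvival h0 zero_le_one le_rfl (one_sub_cdf_law_eventLp hA), one_mul,
    zero_mul, add_zero]

lemma choquet_law_smul_eventLp_add (h0 : h 0 = 0) (hM : MeasurableSet M) (hN : MeasurableSet N)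
    {d : ℝ} (hd : 0 ≤ d) :
    choquet h (law (d • eventLp P q hM + d • eventLp P q hN)) =
      d * (h (P.real (M ∪ N)) + h (P.real (M ∩ N))) := by
  rw [← smul_add, eventLp_add, smul_add, choquet_of_stepSurvival h0 hd hd
    (one_sub_cdf_law_smul_eventLp_add (hM.union hN) (hM.inter hN)
      (inter_subset_left.trans subset_union_left) hd hd), mul_add]

end EventLaws

lemma MConvexOn.mQuasiConvexOn {M : Set (Measure ℝ)} {ρ : Measure ℝ → ℝ} (hρ : MConvexOn M ρ) :
    MQuasiConvexOn M ρ := fun μ hμ ν hν t ht =>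
  (hρ μ hμ ν hν t ht).trans <| Convex.combo_le_max (ρ μ) (ρ ν) ht.1 (sub_nonneg.2 ht.2)
    (add_sub_cancel t 1)

section Uniform

variable {Ω : Type*} [MeasurableSpace Ω] {P : Measure Ω} {q : ℝ≥0∞} {U : Ω → ℝ}

lemma measureReal_preimage_Iic (hU : Measurable U)
    (hlaw : P.map U = (volume : Measure ℝ).restrict (Icc 0 1)) {s : ℝ} (hs : s ∈ Icc (0 : ℝ) 1) :
    P.real (U ⁻¹' Iic s) = s := by
  have hinter : Iic s ∩ Icc 0 1 = Icc 0 s := by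
    rw [inter_comm, ← Ici_inter_Iic, inter_assoc, Iic_inter_Iic, inf_eq_right.2 hs.2, Ici_inter_Iic]
  rw [← map_measureReal_apply hU measurableSet_Iic, hlaw,
    measureReal_restrict_apply measurableSet_Iic, hinter, Real.volume_real_Icc_of_le hs.1, sub_zero]

lemma mem_lawsLp_of_memLp (hP : SupportsUniform P) {μ : Measure ℝ} [IsProbabilityMeasure μ]
    (hμ : MemLp (fun x => x) q μ) : μ ∈ lawsLp P q := by
  obtain ⟨U, hU, hlaw⟩ := hP
  obtain ⟨f, hf, hfμ⟩ := Measure.exists_measurable_map_eq μ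
  set g : ℝ → ℝ := f ∘ projIcc (0 : ℝ) 1 zero_le_one with hg
  have hgm : Measurable g := hf.comp continuous_projIcc.measurable
  have hgf : g ∘ ((↑) : unitInterval → ℝ) = f :=
    funext fun x => congrArg f (projIcc_val zero_le_one x)
  have hmap : P.map (g ∘ U) = μ := by
    rw [← Measure.map_map hgm hU, hlaw, ← unitInterval.measurePreserving_coe.map_eq,
      Measure.map_map hgm measurable_subtype_coe, hgf, hfμ]
  have hmem : MemLp (g ∘ U) q P := by
    rw [← hmap] at hμ
    exact hμ.comp_of_map (hgm.comp hU).aemeasurable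
  exact ⟨hmem.toLp _, (Measure.map_congr hmem.coeFn_toLp).trans hmap⟩

variable [IsProbabilityMeasure P]

lemma mixture_mem_lawsLp (hP : SupportsUniform P) (hq0 : q ≠ 0) (hq : q ≠ ∞) {t : ℝ}
    (ht : t ∈ Icc (0 : ℝ) 1) (X Y : Lp ℝ q P) : mixture t (law X) (law Y) ∈ lawsLp P q := by
  have := isProbabilityMeasure_mixture (μ := law X) (ν := law Y) ht
  exact mem_lawsLp_of_memLp hP (memLp_mixture hq0 hq t (memLp_id_law X) (memLp_id_law Y))

lemma continuous_eventLp_preimage_Iic [Fact (1 ≤ q)] (hq : q ≠ ∞) (hU : Measurable U)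
    (hlaw : P.map U = (volume : Measure ℝ).restrict (Icc 0 1)) :
    Continuous fun s : ℝ => eventLp P q (hU (measurableSet_Iic (a := s))) := by
  refine continuous_indicatorConstLp_set hq fun s => ?_
  have hlim : Tendsto (fun t : ℝ => ENNReal.ofReal |s - t|) (𝓝 s) (𝓝 0) := by
    simpa [Function.comp_def] using
      (ENNReal.continuous_ofReal.comp (continuous_sub_left s).abs).tendsto s
  refine tendsto_of_tendsto_of_tendsto_of_le_of_le tendsto_const_nhds hlim
    (fun _ => zero_le) fun t => ?_
  have hsub : symmDiff (U ⁻¹' Iic t) (U ⁻¹' Iic s) ⊆ U ⁻¹' uIcc t s := by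
    rintro ω (⟨hωt, hωs⟩ | ⟨hωs, hωt⟩)
    · exact mem_uIcc_of_ge (not_le.1 hωs).le hωt
    · exact mem_uIcc_of_le (not_le.1 hωt).le hωs
  calc P (symmDiff (U ⁻¹' Iic t) (U ⁻¹' Iic s)) ≤ P (U ⁻¹' uIcc t s) := measure_mono hsub
    _ = (volume : Measure ℝ).restrict (Icc 0 1) (uIcc t s) := by
        rw [← hlaw, Measure.map_apply hU measurableSet_uIcc]
    _ ≤ volume (uIcc t s) := Measure.restrict_apply_le _ _
    _ = ENNReal.ofReal |s - t| := Real.volume_interval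

variable [Fact (1 ≤ q)] {h : ℝ → ℝ}

lemma continuousOn_of_continuous_choquet (hP : SupportsUniform P) (hq : q ≠ ∞) (h0 : h 0 = 0)
    (hcont : Continuous fun X : Lp ℝ q P => choquet h (law X)) : ContinuousOn h (Icc 0 1) := by
  obtain ⟨U, hU, hlaw⟩ := hP
  refine (hcont.comp (continuous_eventLp_preimage_Iic hq hU hlaw)).continuousOn.congr fun s hs => ?_
  rw [Function.comp_apply, choquet_law_eventLp h0, measureReal_preimage_Iic hU hlaw hs]

lemma mConvexOn_choquet (hP : SupportsUniform P) (hq : q ≠ ∞) (hconv : ConvexOn ℝ (Icc 0 1) h)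
    (hfin : ∀ X : Lp ℝ q P, HasFiniteChoquet h (law X)) :
    MConvexOn (lawsLp P q) (choquet h) := by
  rintro _ ⟨X, rfl⟩ _ ⟨Y, rfl⟩ t ht
  have hq0 : q ≠ 0 := (zero_lt_one.trans_le Fact.out).ne'
  obtain ⟨Z, hZ⟩ := mixture_mem_lawsLp hP hq0 hq ht X Y
  exact choquet_mixture_le hconv ht (hfin X) (hfin Y) (hZ ▸ hfin Z)

end Uniform

section Necessity

variable {Ω : Type*} [MeasurableSpace Ω] {P : Measure Ω} {q : ℝ≥0∞} {h : ℝ → ℝ}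

/- For `m = (a + b) / 2` the events `{U ≤ m}` and `{U ≤ a} ∪ {m < U ≤ b}` have probability `m`,
their intersection and union have probability `a` and `b`. -/
lemma convexOn_of_supermodular_of_measureReal_eq [IsFiniteMeasure P] (hP : SupportsUniform P)
    (hh : ContinuousOn h (Icc 0 1))
    (H : ∀ M N : Set Ω, MeasurableSet M → MeasurableSet N → P.real M = P.real N →
      h (P.real M) + h (P.real N) ≤ h (P.real (M ∪ N)) + h (P.real (M ∩ N))) :
    ConvexOn ℝ (Icc 0 1) h := by
  obtain ⟨U, hU, hlaw⟩ := hP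
  refine convexOn_of_midpoint hh fun a ha b hb hab => ?_
  set m := (a + b) / 2 with hm
  have ham : a ≤ m := by linarith
  have hmb : m ≤ b := by linarith
  have hA := measureReal_preimage_Iic hU hlaw ha
  have hB := measureReal_preimage_Iic hU hlaw hb
  have hM := measureReal_preimage_Iic hU hlaw ⟨ha.1.trans ham, hmb.trans hb.2⟩
  have hunion : U ⁻¹' Iic m ∪ U ⁻¹' (Iic a ∪ Ioc m b) = U ⁻¹' Iic b := by
    rw [← preimage_union, ← union_assoc, union_eq_left.2 (Iic_subset_Iic.2 ham),
      Iic_union_Ioc_eq_Iic hmb]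
  have hinter : U ⁻¹' Iic m ∩ U ⁻¹' (Iic a ∪ Ioc m b) = U ⁻¹' Iic a := by
    rw [← preimage_inter, inter_union_distrib_left, inter_eq_right.2 (Iic_subset_Iic.2 ham),
      (Iic_disjoint_Ioc le_rfl).inter_eq, union_empty]
  have hmeas : MeasurableSet (U ⁻¹' (Iic a ∪ Ioc m b)) :=
    hU (measurableSet_Iic.union measurableSet_Ioc)
  have hN : P.real (U ⁻¹' (Iic a ∪ Ioc m b)) = m := by
    have hsum := measureReal_union_add_inter (μ := P) (s := U ⁻¹' Iic m) hmeas
    rw [hunion, hinter, hA, hB, hM] at hsum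
    linarith
  have := H (U ⁻¹' Iic m) _ (hU measurableSet_Iic) hmeas (hM.trans hN.symm)
  rw [hunion, hinter, hA, hB, hM, hN] at this
  linarith

variable [IsProbabilityMeasure P]

lemma convexOn_of_superadditive (hP : SupportsUniform P) (hh : ContinuousOn h (Icc 0 1))
    (h0 : h 0 = 0)
    (H : ∀ X Y : Lp ℝ q P, choquet h (law X) + choquet h (law Y) ≤ choquet h (law (X + Y))) :
    ConvexOn ℝ (Icc 0 1) h := by
  refine convexOn_of_supermodular_of_measureReal_eq hP hh fun M N hM hN _ => ?_
  have hMN := H (eventLp P q hM) (eventLp P q hN)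
  have hsum := choquet_law_smul_eventLp_add (P := P) (q := q) h0 hM hN zero_le_one
  rw [one_smul, one_smul, one_mul] at hsum
  rwa [choquet_law_eventLp h0, choquet_law_eventLp h0, hsum] at hMN

lemma convexOn_of_le_choquet_midpoint (hP : SupportsUniform P) (hh : ContinuousOn h (Icc 0 1))
    (h0 : h 0 = 0) (H : ∀ X Y : Lp ℝ q P, law X = law Y →
      choquet h (law X) ≤ choquet h (law ((1 / 2 : ℝ) • X + (1 / 2 : ℝ) • Y))) :
    ConvexOn ℝ (Icc 0 1) h := by
  refine convexOn_of_supermodular_of_measureReal_eq hP hh fun M N hM hN hMN => ?_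
  have hmid := H (eventLp P q hM) (eventLp P q hN) (law_eventLp_congr hM hN hMN)
  rw [choquet_law_eventLp h0, choquet_law_smul_eventLp_add h0 hM hN one_half_pos.le] at hmid
  rw [← hMN]
  linarith

lemma convexOn_of_mQuasiConvexOn (hP : SupportsUniform P) (hh : ContinuousOn h (Icc 0 1))
    (h0 : h 0 = 0) (H : MQuasiConvexOn (lawsLp P q) (choquet h)) : ConvexOn ℝ (Icc 0 1) h := by
  obtain ⟨U, hU, hlaw⟩ := hP
  refine convexOn_of_weighted_quasiconvex hh
    fun s₁ hs₁ s₂ hs₂ t₁ ht₁ t₂ ht₂ hs ht d₁ d₂ hd₁ hd₂ => ?_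
  have hstep {r₁ r₂ : ℝ} (hr₁ : r₁ ∈ Icc (0 : ℝ) 1) (hr₂ : r₂ ∈ Icc (0 : ℝ) 1) (hr : r₂ ≤ r₁) :
      ∃ X : Lp ℝ q P, ∀ x, 1 - cdf (law X) x = stepSurvival d₁ d₂ r₁ r₂ x := by
    have hX := one_sub_cdf_law_smul_eventLp_add (P := P) (q := q)
      (hU (measurableSet_Iic (a := r₁))) (hU (measurableSet_Iic (a := r₂)))
      (preimage_mono (Iic_subset_Iic.2 hr)) hd₁ hd₂
    rw [measureReal_preimage_Iic hU hlaw hr₁, measureReal_preimage_Iic hU hlaw hr₂] at hX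
    exact ⟨_, hX⟩
  obtain ⟨X, hX⟩ := hstep hs₁ hs₂ hs
  obtain ⟨Y, hY⟩ := hstep ht₁ ht₂ ht
  have hhalf : (1 / 2 : ℝ) ∈ Icc (0 : ℝ) 1 := ⟨one_half_pos.le, one_half_lt_one.le⟩
  have hXY := H _ ⟨X, rfl⟩ _ ⟨Y, rfl⟩ (1 / 2) hhalf
  rw [choquet_of_stepSurvival h0 hd₁ hd₂ (one_sub_cdf_mixture_of_stepSurvival hhalf hX hY),
    choquet_of_stepSurvival h0 hd₁ hd₂ hX, choquet_of_stepSurvival h0 hd₁ hd₂ hY] at hXY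
  have hmid (x y : ℝ) : 1 / 2 * x + (1 - 1 / 2) * y = (x + y) / 2 := by ring
  rwa [hmid, hmid] at hXY

end Necessity

section MixedQuantile

lemma mixedQuantile_eq_of_jump {μ : Measure ℝ} {α y : ℝ} (c : ℝ) (hlt : ∀ x < y, cdf μ x < α)
    (hgt : α < cdf μ y) : mixedQuantile c α μ = y := by
  have hright : {x | α < cdf μ x} = Ici y :=
    Subset.antisymm (fun x hx => not_lt.1 fun hxy => (hlt x hxy).not_gt hx)
      fun _ hx => hgt.trans_le (monotone_cdf μ hx)
  have hleft : {x | α ≤ cdf μ x} = Ici y :=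
    Subset.antisymm (fun x hx => not_lt.1 fun hxy => (hlt x hxy).not_ge hx)
      fun _ hx => hgt.le.trans (monotone_cdf μ hx)
  rw [mixedQuantile, rightQuantile, leftQuantile, hright, hleft, csInf_Ici]
  ring

variable {Ω : Type*} [MeasurableSpace Ω] {P : Measure Ω} [IsProbabilityMeasure P] {q : ℝ≥0∞}
  {A : Set Ω} {α : ℝ}

lemma mixedQuantile_law_eventLp_of_lt (hA : MeasurableSet A) (hα : 0 < α) (c : ℝ)
    (hPA : P.real A < 1 - α) : mixedQuantile c α (law (eventLp P q hA)) = 0 := by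
  have hcdf := one_sub_cdf_law_eventLp (P := P) (q := q) hA
  refine mixedQuantile_eq_of_jump c (fun x hx => ?_) ?_
  · have := hcdf x
    rw [stepSurvival, if_pos hx] at this
    linarith
  · have := hcdf 0
    rw [stepSurvival, if_neg (lt_irrefl 0), if_pos one_pos] at this
    linarith

lemma mixedQuantile_law_eventLp_of_gt (hA : MeasurableSet A) (hα : α < 1) (c : ℝ)
    (hPA : 1 - α < P.real A) : mixedQuantile c α (law (eventLp P q hA)) = 1 := by
  have hcdf := one_sub_cdf_law_eventLp (P := P) (q := q) hA
  refine mixedQuantile_eq_of_jump c (fun x hx => ?_) ?_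
  · have hmax := hcdf (max x 0)
    rw [stepSurvival, if_neg (le_max_right x 0).not_gt, if_pos (max_lt hx one_pos)] at hmax
    linarith [monotone_cdf (law (eventLp P q hA)) (le_max_left x 0)]
  · have := hcdf 1
    norm_num [stepSurvival] at this
    linarith

lemma not_continuous_mixedQuantile [Fact (1 ≤ q)] (hP : SupportsUniform P) (hq : q ≠ ∞)
    (hα : α ∈ Ioo (0 : ℝ) 1) (c : ℝ) :
    ¬ Continuous fun X : Lp ℝ q P => mixedQuantile c α (law X) := by
  obtain ⟨U, hU, hlaw⟩ := hP
  intro hcont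
  have hcomp := hcont.comp (continuous_eventLp_preimage_Iic hq hU hlaw)
  have hα₀ : 0 < 1 - α := sub_pos.2 hα.2
  have hα₁ : 1 - α < 1 := sub_lt_self 1 hα.1
  have hzero := EqOn.closure (s := Ioo 0 (1 - α)) (g := fun _ => (0 : ℝ)) (fun s hs =>
    mixedQuantile_law_eventLp_of_lt _ hα.1 c <|
      (measureReal_preimage_Iic hU hlaw ⟨hs.1.le, (hs.2.trans hα₁).le⟩).trans_lt hs.2)
    hcomp continuous_const
  have hone := EqOn.closure (s := Ioo (1 - α) 1) (g := fun _ => (1 : ℝ)) (fun s hs =>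
    mixedQuantile_law_eventLp_of_gt _ hα.2 c <|
      hs.1.trans_eq (measureReal_preimage_Iic hU hlaw ⟨(hα₀.trans hs.1).le, hs.2.le⟩).symm)
    hcomp continuous_const
  rw [closure_Ioo hα₀.ne] at hzero
  rw [closure_Ioo hα₁.ne] at hone
  exact zero_ne_one <|
    (hzero (right_mem_Icc.2 hα₀.le)).symm.trans (hone (left_mem_Icc.2 hα₁.le))

end MixedQuantile

end SignedChoquet

theorem mainTheorem5_general {Ω : Type*} [MeasurableSpace Ω] (P : Measure Ω)
    [IsProbabilityMeasure P] (hP : SignedChoquet.SupportsUniform P) (q : ℝ≥0∞) [Fact (1 ≤ q)]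
    (hq : q ≠ ∞) :
    (∀ h : ℝ → ℝ,
      (∀ X : Lp ℝ q P, SignedChoquet.HasFiniteChoquet h (SignedChoquet.law X)) →
      Continuous (fun X : Lp ℝ q P => SignedChoquet.choquet h (SignedChoquet.law X)) →
      List.TFAE
        [ConvexOn ℝ (Icc (0 : ℝ) 1) h,
          SignedChoquet.ConcaveOrderMonotoneOn (SignedChoquet.lawsLp P q)
            (SignedChoquet.choquet h),
          ∀ X Y : Lp ℝ q P,
            SignedChoquet.choquet h (SignedChoquet.law X)
              + SignedChoquet.choquet h (SignedChoquet.law Y)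
              ≤ SignedChoquet.choquet h (SignedChoquet.law (X + Y)),
          ConcaveOn ℝ univ (fun X : Lp ℝ q P => SignedChoquet.choquet h (SignedChoquet.law X)),
          QuasiconcaveOn ℝ univ
            (fun X : Lp ℝ q P => SignedChoquet.choquet h (SignedChoquet.law X)),
          SignedChoquet.MConvexOn (SignedChoquet.lawsLp P q) (SignedChoquet.choquet h),
          SignedChoquet.MQuasiConvexOn (SignedChoquet.lawsLp P q) (SignedChoquet.choquet h)]) ∧
    (∀ α ∈ Ioo (0 : ℝ) 1, ∀ c : ℝ,
      ¬ Continuous (fun X : Lp ℝ q P =>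
        SignedChoquet.mixedQuantile c α (SignedChoquet.law X))) := by
  refine ⟨fun h hfin hcont => ?_, fun α hα => SignedChoquet.not_continuous_mixedQuantile hP hq hα⟩
  have h0 := SignedChoquet.map_zero_of_hasFiniteChoquet_law (hfin 0)
  have hh := SignedChoquet.continuousOn_of_continuous_choquet hP hq h0 hcont
  have hhalf : (0 : ℝ) ≤ 1 / 2 := one_half_pos.le
  tfae_have 1 → 2 := by
    rintro hconv _ ⟨X, rfl⟩ _ ⟨Y, rfl⟩ hle
    exact SignedChoquet.choquet_le_of_concaveOrderLE hconv hh h0 (SignedChoquet.integrable_id_law X)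
      (SignedChoquet.integrable_id_law Y) (hfin X) (hfin Y) hle
  tfae_have 2 → 1 := fun H => SignedChoquet.convexOn_of_le_choquet_midpoint hP hh h0
    fun _ _ hXY => H _ ⟨_, rfl⟩ _ ⟨_, rfl⟩ <|
      SignedChoquet.concaveOrderLE_law_convexComb hXY hhalf hhalf (add_halves 1)
  tfae_have 1 → 3 := fun hconv X Y => by
    simpa using SignedChoquet.choquet_law_superlinear hconv hh hfin zero_le_one zero_le_one X Y
  tfae_have 3 → 1 := SignedChoquet.convexOn_of_superadditive hP hh h0
  tfae_have 1 → 4 := fun hconv => ⟨convex_univ, fun X _ Y _ _ _ ha hb _ =>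
    SignedChoquet.choquet_law_superlinear hconv hh hfin ha hb X Y⟩
  tfae_have 4 → 5 := ConcaveOn.quasiconcaveOn
  tfae_have 5 → 1 := fun H => SignedChoquet.convexOn_of_le_choquet_midpoint hP hh h0
    fun _ _ hXY => (H _ ⟨mem_univ _, le_rfl⟩ ⟨mem_univ _, (congrArg _ hXY).le⟩ hhalf hhalf
      (add_halves 1)).2
  tfae_have 1 → 6 := fun hconv => SignedChoquet.mConvexOn_choquet hP hq hconv hfin
  tfae_have 6 → 7 := SignedChoquet.MConvexOn.mQuasiConvexOn
  tfae_have 7 → 1 := SignedChoquet.convexOn_of_mQuasiConvexOn hP hh h0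
  tfae_finish

theorem mainTheorem5 {Ω : Type*} [MeasurableSpace Ω] (P : Measure Ω) [IsProbabilityMeasure P]
    (hP : SignedChoquet.SupportsUniform P) (q : ℝ≥0∞) [Fact (1 ≤ q)] (hq : q ≠ ∞) :
    (∀ h : ℝ → ℝ, SignedChoquet.IsDistortion h →
      (∀ X : Lp ℝ q P, SignedChoquet.HasFiniteChoquet h (SignedChoquet.law X)) →
      Continuous (fun X : Lp ℝ q P => SignedChoquet.choquet h (SignedChoquet.law X)) →
      List.TFAE
        [ConvexOn ℝ (Icc (0 : ℝ) 1) h,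
          SignedChoquet.ConcaveOrderMonotoneOn (SignedChoquet.lawsLp P q)
            (SignedChoquet.choquet h),
          ∀ X Y : Lp ℝ q P,
            SignedChoquet.choquet h (SignedChoquet.law X)
              + SignedChoquet.choquet h (SignedChoquet.law Y)
              ≤ SignedChoquet.choquet h (SignedChoquet.law (X + Y)),
          ConcaveOn ℝ univ (fun X : Lp ℝ q P => SignedChoquet.choquet h (SignedChoquet.law X)),
          QuasiconcaveOn ℝ univ
            (fun X : Lp ℝ q P => SignedChoquet.choquet h (SignedChoquet.law X)),
          SignedChoquet.MConvexOn (SignedChoquet.lawsLp P q) (SignedChoquet.choquet h),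
          SignedChoquet.MQuasiConvexOn (SignedChoquet.lawsLp P q) (SignedChoquet.choquet h)]) ∧
    (∀ α ∈ Ioo (0 : ℝ) 1, ∀ c ∈ Icc (0 : ℝ) 1,
      ¬ Continuous (fun X : Lp ℝ q P =>
        SignedChoquet.mixedQuantile c α (SignedChoquet.law X))) :=
  ⟨fun h _ hfin hcont => (mainTheorem5_general P hP q hq).1 h hfin hcont,
    fun α hα c _ => (mainTheorem5_general P hP q hq).2 α hα c⟩
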